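/- \textbf{Theorem (Local $L^2$ Distribution Estimation: Standard Errors).} Let $x_1,x_2,\dots$ be i.i.d. real random variables with distribution function $F$, let $\mathcal X\subseteq\mathbb R$ be the support of their law and let $\mathsf x\in\mathcal X$. Let $\hat F(u)=\frac1n\sum_{i=1}^n \mathbf 1(x_i\le u)$. Let $K:\mathbb R\to\mathbb R$ be a kernel, $R:\mathbb R\to\mathbb R^d$ a (measurable) basis function, and $G:\mathbb R\to\mathbb R$ a nondecreasing right-continuous weighting function. Assume: (1) For some $\delta>0$, $F$ is absolutely continuous on $[\mathsf x-\delta,\mathsf x+\delta]$ with a density $f$ for which there are constants $f(\mathsf x-),f(\mathsf x+),\dot f(\mathsf x-),\dot f(\mathsf x+)\in\mathbb R$ with $$\sup_{u\in[-\delta,0)}\frac{f(\mathsf x+u)-f(\mathsf x-)-u\dot f(\mathsf x-)}{u^2}+\sup_{u\in(0,\delta]}\frac{f(\mathsf x+u)-f(\mathsf x+)-u\dot f(\mathsf x+)}{u^2}<\infty .$$ (2) $K$ is nonnegative, symmetric, continuous on its support $[-1,1]$, and integrates to $1$. (3) $R$ is locally bounded and, for each $h>0$, $\Upsilon_h$ is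 a positive-definite diagonal matrix with $\Upsilon_hR(u)=R(u/h)$ for all $u$. (4) For some $\delta>0$, $G$ is absolutely continuous on $[\mathsf x-\delta,\mathsf x+\delta]$ with a derivative $g\ge 0$ that satisfies the condition displayed in (1), with $g$ in place of $f$. (5) For all $h>0$ sufficiently small, the minimum eigenvalues of $\Gamma_h$ and $h^{-1}\Sigma_h$ are bounded away from zero, where, with $\mathcal X_h=(\mathcal X-\mathsf x)/h$, $$\Gamma_h=\int_{\mathcal X_h}R(u)R(u)'K(u)g(\mathsf x+hu)\,du,$$ $$\Sigma_h=\iint_{\mathcal X_h\times\mathcal X_h}R(u)R(v)'\big[F(\mathsf x+h(u\wedge v))-F(\mathsf x+hu)F(\mathsf x+hv)\big]K(u)K(v)g(\mathsf x+hu)g(\mathsf x+hv)\,du\,dv.$$ Let $h=h_n>0$ be a deterministic sequence with $h\to0$ and $nh\to\infty$ as $n\to\infty$, let $c\in\mathbb R^d$ be nonzero, and let $$\hat\Sigma_h=\frac1n\sum_{i=1}^n\iint_{\mathcal X_h\times\mathcal X_h}R(u)R(v)'\big[\mathbf 1(x_i\le\mathsf x+hu)-\hat F(\mathsf x+hu)\big]\big[\mathbf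 1(x_i\le\mathsf x+hv)-\hat F(\mathsf x+hv)\big]K(u)K(v)g(\mathsf x+hu)g(\mathsf x+hv)\,du\,dv.$$ Then $$\left|\frac{c'\hat\Sigma_hc}{c'\Sigma_hc}-1\right|=O_{\mathbb P}\!\left(\sqrt{\frac1{nh}}\right).$$ Moreover, let $\theta\in\mathbb R^d$, put $\varrho(h)=\sup_{|x-\mathsf x|\le h}|F(x)-R(x-\mathsf x)'\theta|$, and let $\hat\theta_G$ be a (measurable) minimizer over $\vartheta\in\mathbb R^d$ of $$\int_{\mathcal X}\big(\hat F(u)-R(u-\mathsf x)'\vartheta\big)^2\,\frac1hK\!\left(\frac{u-\mathsf x}h\right)dG(u).$$ If in addition $n\varrho(h)^2/h\to0$, then $$\frac{c'(\hat\theta_G-\theta)}{\sqrt{c'\Upsilon_h\Gamma_h^{-1}\hat\Sigma_h\Gamma_h^{-1}\Upsilon_hc/n}}\;\rightsquigarrow\;\mathcal N(0,1).$$ -/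

import Mathlib

open MeasureTheory ProbabilityTheory Filter Topology Set
open scoped Matrix

namespace LocalL2

noncomputable section

/-- `X n = O_P(a n)`: for every `ε > 0` there is a constant `M` such that
`μ (|X n| > M * a n) ≤ ε` for all large `n`. -/
def IsBigOInProbability {Ω : Type*} [MeasurableSpace Ω] (μ : Measure Ω)
    (X : ℕ → Ω → ℝ) (a : ℕ → ℝ) : Prop :=
  ∀ ε : ℝ, 0 < ε → ∃ M : ℝ, ∀ᶠ n in atTop, μ {ω | M * a n < |X n ω|} ≤ ENNReal.ofReal ε

/-- The empirical distribution function of the first `n` entries of `x`, evaluated at `u`. -/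
def empiricalCDF (n : ℕ) (x : ℕ → ℝ) (u : ℝ) : ℝ :=
  (1 / (n : ℝ)) * ∑ i ∈ Finset.range n, (if x i ≤ u then 1 else 0)

/-- The rescaled support `(𝒳 - x₀) / h`, where `𝒳` is the support of the law `P`. -/
def rescaledSupport (P : Measure ℝ) (x₀ h : ℝ) : Set ℝ := {u | x₀ + h * u ∈ P.support}

/-- `ϱ(h) = sup_{|y - x₀| ≤ h} |F(y) - R(y - x₀)' θ|`. -/
def approxError {d : ℕ} (P : Measure ℝ) (R : ℝ → Fin d → ℝ) (x₀ : ℝ) (θ : Fin d → ℝ)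
    (h : ℝ) : ℝ :=
  sSup ((fun y => |cdf P y - R (y - x₀) ⬝ᵥ θ|) '' {y | |y - x₀| ≤ h})

/-- The local `L²` criterion
`θ ↦ ∫_𝒳 (F̂(u) - R(u - x₀)' θ)² (1/h) K((u - x₀)/h) dG(u)`. -/
def criterion {d : ℕ} (P : Measure ℝ) (R : ℝ → Fin d → ℝ) (K : ℝ → ℝ)
    (G : StieltjesFunction ℝ) (x₀ h : ℝ) (n : ℕ) (x : ℕ → ℝ) (θ : Fin d → ℝ) : ℝ :=
  ∫ u in P.support,
    (empiricalCDF n x u - R (u - x₀) ⬝ᵥ θ) ^ 2 * ((1 / h) * K ((u - x₀) / h)) ∂G.measure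

/-- `Γ_h = ∫ R(u) R(u)' K(u) g(x₀ + h u) du` over `(𝒳 - x₀) / h`. -/
def Gam {d : ℕ} (P : Measure ℝ) (R : ℝ → Fin d → ℝ) (K g : ℝ → ℝ) (x₀ h : ℝ) :
    Matrix (Fin d) (Fin d) ℝ :=
  Matrix.of fun j k =>
    ∫ u in rescaledSupport P x₀ h, R u j * R u k * K u * g (x₀ + h * u)

/-- `Σ_h = ∬ R(u) R(v)' [F(x₀ + h (u ∧ v)) - F(x₀ + h u) F(x₀ + h v)]
K(u) K(v) g(x₀ + h u) g(x₀ + h v) du dv` over `(𝒳 - x₀) / h`. -/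
def Sig {d : ℕ} (P : Measure ℝ) (R : ℝ → Fin d → ℝ) (K g : ℝ → ℝ) (x₀ h : ℝ) :
    Matrix (Fin d) (Fin d) ℝ :=
  Matrix.of fun j k =>
    ∫ v in rescaledSupport P x₀ h, ∫ u in rescaledSupport P x₀ h,
      R u j * R v k
        * (cdf P (x₀ + h * min u v) - cdf P (x₀ + h * u) * cdf P (x₀ + h * v))
        * K u * K v * g (x₀ + h * u) * g (x₀ + h * v)

/-- The plug-in estimator `Σ̂_h` of `Σ_h`, computed from the first `n` entries of `x`. -/
def SigHat {d : ℕ} (P : Measure ℝ) (R : ℝ → Fin d → ℝ) (K g : ℝ → ℝ) (x₀ h : ℝ)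
    (n : ℕ) (x : ℕ → ℝ) : Matrix (Fin d) (Fin d) ℝ :=
  Matrix.of fun j k =>
    (1 / (n : ℝ)) * ∑ i ∈ Finset.range n,
      ∫ v in rescaledSupport P x₀ h, ∫ u in rescaledSupport P x₀ h,
        R u j * R v k
          * ((if x i ≤ x₀ + h * u then 1 else 0) - empiricalCDF n x (x₀ + h * u))
          * ((if x i ≤ x₀ + h * v then 1 else 0) - empiricalCDF n x (x₀ + h * v))
          * K u * K v * g (x₀ + h * u) * g (x₀ + h * v)

/-- `H` is absolutely continuous on `[x₀ - δ, x₀ + δ]` with derivative (density) `p` there, and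
there are constants `pm, pp, dpm, dpp` such that
`sup_{u ∈ [-δ, 0)} (p(x₀ + u) - pm - u dpm) / u²` and
`sup_{u ∈ (0, δ]} (p(x₀ + u) - pp - u dpp) / u²` are finite. -/
def HasLocalDensity (H p : ℝ → ℝ) (x₀ δ : ℝ) : Prop :=
  AbsolutelyContinuousOnInterval H (x₀ - δ) (x₀ + δ) ∧
  (∀ᵐ y, y ∈ Icc (x₀ - δ) (x₀ + δ) → HasDerivAt H (p y) y) ∧
  ∃ pm pp dpm dpp : ℝ,
    BddAbove ((fun u => (p (x₀ + u) - pm - u * dpm) / u ^ 2) '' Ico (-δ) 0) ∧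
    BddAbove ((fun u => (p (x₀ + u) - pp - u * dpp) / u ^ 2) '' Ioc 0 δ)

/-- The kernel is nonnegative, symmetric, continuous on its support `[-1, 1]`, and integrates
to one. -/
structure IsKernel (K : ℝ → ℝ) : Prop where
  nonneg : ∀ u, 0 ≤ K u
  symm : ∀ u, K (-u) = K u
  tsupport_eq : tsupport K = Icc (-1) 1
  continuousOn : ContinuousOn K (Icc (-1) 1)
  integral_eq_one : ∫ u, K u = 1

/-- The basis is (measurable and) locally bounded, and `Υ_h = diag(υ h)` is a positive definite
diagonal matrix with `Υ_h R(u) = R(u / h)` for each `h > 0`. -/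
structure IsScalableBasis {d : ℕ} (R : ℝ → Fin d → ℝ) (υ : ℝ → Fin d → ℝ) : Prop where
  measurable : Measurable R
  locallyBounded : ∀ r : ℝ, ∃ C : ℝ, ∀ u, |u| ≤ r → ∀ j, |R u j| ≤ C
  scale_pos : ∀ h, 0 < h → ∀ j, 0 < υ h j
  scale_eq : ∀ h, 0 < h → ∀ u, Matrix.diagonal (υ h) *ᵥ R u = R (u / h)

/-- Every eigenvalue of `M` is at least `ε`. -/
def EigenvaluesGE {d : ℕ} (M : Matrix (Fin d) (Fin d) ℝ) (ε : ℝ) : Prop :=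
  ∀ l : ℝ, Module.End.HasEigenvalue (Matrix.toLin' M) l → ε ≤ l

/-- The assumptions on the data generating process, the kernel and the basis. -/
structure DGPAssumption {d : ℕ} (P : Measure ℝ) (R υ : ℝ → Fin d → ℝ) (K g : ℝ → ℝ)
    (x₀ : ℝ) : Prop where
  mem_support : x₀ ∈ P.support
  smooth : ∃ δ > 0, ∃ f : ℝ → ℝ, HasLocalDensity (cdf P) f x₀ δ
  kernel : IsKernel K
  basis : IsScalableBasis R υ
  eigenvalues : ∃ ε > 0, ∀ᶠ h in 𝓝[>] (0 : ℝ),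
    EigenvaluesGE (Gam P R K g x₀ h) ε ∧ EigenvaluesGE (h⁻¹ • Sig P R K g x₀ h) ε

/-- The assumptions on the design weighting `G` and its derivative `g` near `x₀`. -/
structure DesignAssumption (G : StieltjesFunction ℝ) (g : ℝ → ℝ) (x₀ : ℝ) : Prop where
  measurable : Measurable g
  smooth : ∃ δ > 0, HasLocalDensity G g x₀ δ ∧ ∀ y ∈ Icc (x₀ - δ) (x₀ + δ), 0 ≤ g y

end

end LocalL2

/-! ### Averages of bounded i.i.d. variables: empirical variance and a triangular-array CLT. -/

namespace LocalL2

variable {Ω : Type*} [MeasurableSpace Ω] {μ : Measure Ω} {P : Measure ℝ} {X : ℕ → Ω → ℝ}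

/-! Everything reduces to averages of one bounded function. Put ψ_j(y) = ∫ R_j(u) K(u) g(x₀ + hu)
[1(y ≤ x₀ + hu) - F(x₀ + hu)] du. By Fubini ψ_j has mean zero under P and Σ_h is the covariance
matrix of ψ (`dotProduct_Sig`). Centering the indicators at the empirical distribution function
instead of F subtracts the sample mean of ψ_j, so Σ̂_h is exactly the empirical covariance matrix
(`dotProduct_SigHat`).

For a direction b, the variable b'ψ is bounded by a constant times |b| uniformly in small h, while
the eigenvalue condition makes its variance s at least ε h |b|². Hence the ratio bound/√(ns) is
O(1/√(nh)), uniformly in b. This single ratio controls the mean relative error of the empirical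
variance (`integral_abs_empVar_div_sub_one_le`), which with Markov's inequality gives the rate. It
is also a Lyapunov-type ratio: when it vanishes, a third-order bound on the characteristic function
yields the CLT (`tendstoInDistribution_avg`).

For the estimator, the kernel localizes dG to the region where it equals g du. The normal equations
then give Γ_h Υ_h⁻¹(θ̂ - θ) = average of ψ + bias, so that c'(θ̂ - θ) = average of a'ψ + a'bias with
a = Γ_h⁻¹ Υ_h c (`dotProduct_sub_eq`). The vector a may blow up or vanish with h, which is harmless
because all bounds are homogeneous in b. The standardized bias is at most a constant times √(n
ϱ(h)²/h), the studentizing factor tends to 1 in probability, and Slutsky's theorem concludes. -/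

/-- The average of `f` over the first `n` entries of `x`. -/
noncomputable def avg (n : ℕ) (f : ℝ → ℝ) (x : ℕ → ℝ) : ℝ :=
  (1 / (n : ℝ)) * ∑ i ∈ Finset.range n, f (x i)

/-- The empirical variance of `f` over the first `n` entries of `x`. -/
noncomputable def empVar (n : ℕ) (f : ℝ → ℝ) (x : ℕ → ℝ) : ℝ :=
  avg n (fun y => (f y - avg n f x) ^ 2) x

lemma empVar_eq {n : ℕ} (hn : n ≠ 0) (f : ℝ → ℝ) (x : ℕ → ℝ) :
    empVar n f x = avg n (fun y => f y ^ 2) x - avg n f x ^ 2 := by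
  have hn' : (n : ℝ) ≠ 0 := by exact_mod_cast hn
  have h1 : ∑ i ∈ Finset.range n, f (x i) = n * avg n f x := by
    unfold avg; field_simp
  unfold empVar
  set m := avg n f x with hm
  unfold avg
  simp_rw [sub_sq, Finset.sum_add_distrib, Finset.sum_sub_distrib, ← Finset.sum_mul,
    ← Finset.mul_sum, h1]
  simp
  field_simp
  ring

lemma aemeasurable_avg (hX : ∀ i, AEMeasurable (X i) μ) {f : ℝ → ℝ} (hf : Measurable f) (n : ℕ) :
    AEMeasurable (fun ω => avg n f (fun i => X i ω)) μ := by
  unfold avg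
  exact (Finset.aemeasurable_fun_sum _ fun i _ => hf.comp_aemeasurable (hX i)).const_mul _

lemma abs_avg_le {n : ℕ} {f : ℝ → ℝ} {C : ℝ} (hC : ∀ y, |f y| ≤ C) (x : ℕ → ℝ) :
    |avg n f x| ≤ C := by
  have hC0 : 0 ≤ C := (abs_nonneg _).trans (hC 0)
  rcases Nat.eq_zero_or_pos n with rfl | hn
  · simpa [avg] using hC0
  have hn' : (0 : ℝ) < n := by exact_mod_cast hn
  unfold avg
  rw [abs_mul, abs_of_pos (by positivity), one_div, inv_mul_le_iff₀ hn']
  calc |∑ i ∈ Finset.range n, f (x i)| ≤ ∑ i ∈ Finset.range n, |f (x i)| :=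
        Finset.abs_sum_le_sum_abs _ _
    _ ≤ ∑ i ∈ Finset.range n, C := Finset.sum_le_sum fun i _ => hC _
    _ = n * C := by simp

lemma memLp_of_bounded {f : ℝ → ℝ} (hf : Measurable f) {C : ℝ} (hC : ∀ y, |f y| ≤ C)
    (Q : Measure ℝ) [IsFiniteMeasure Q] (p : ENNReal) : MemLp f p Q :=
  MemLp.of_bound hf.aestronglyMeasurable C (ae_of_all _ hC)

/-- The mean squared error of an average of bounded i.i.d. variables. -/
lemma integral_sq_avg_sub_le [IsProbabilityMeasure μ]
    (hlaw : ∀ i, HasLaw (X i) P μ) (hindep : iIndepFun X μ)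
    {f : ℝ → ℝ} (hf : Measurable f) {C : ℝ} (hC : ∀ y, |f y| ≤ C) {n : ℕ} (hn : n ≠ 0) :
    ∫ ω, (avg n f (fun i => X i ω) - ∫ y, f y ∂P) ^ 2 ∂μ ≤ (∫ y, f y ^ 2 ∂P) / n := by
  have hn' : (n : ℝ) ≠ 0 := by exact_mod_cast hn
  have hX i := (hlaw i).aemeasurable
  have hint (i : ℕ) : ∫ ω, f (X i ω) ∂μ = ∫ y, f y ∂P :=
    (hlaw i).integral_comp hf.aestronglyMeasurable
  have hL (i : ℕ) : MemLp (fun ω => f (X i ω)) 2 μ :=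
    MemLp.of_bound (hf.comp_aemeasurable (hX i)).aestronglyMeasurable C (ae_of_all _ fun ω => hC _)
  have hmean : ∫ ω, avg n f (fun i => X i ω) ∂μ = ∫ y, f y ∂P := by
    unfold avg
    rw [integral_const_mul, integral_finsetSum _ fun i _ => (hL i).integrable (by norm_num)]
    simp [hint, hn']
  rw [← hmean, ← variance_eq_integral (aemeasurable_avg hX hf n)]
  unfold avg
  rw [variance_const_mul]
  have hs : (fun ω => ∑ i ∈ Finset.range n, f (X i ω))
      = ∑ i ∈ Finset.range n, (fun ω => f (X i ω)) := by ext; simp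
  rw [hs, IndepFun.variance_sum (fun i _ => hL i)]
  · have hv (i : ℕ) : Var[fun ω => f (X i ω); μ] ≤ ∫ y, f y ^ 2 ∂P := by
      refine (variance_le_expectation_sq (hL i).1).trans_eq ?_
      exact (hlaw i).integral_comp (f := fun y => f y ^ 2) (hf.pow_const 2).aestronglyMeasurable
    calc (1 / (n : ℝ)) ^ 2 * ∑ i ∈ Finset.range n, Var[fun ω => f (X i ω); μ]
        ≤ (1 / (n : ℝ)) ^ 2 * ∑ i ∈ Finset.range n, ∫ y, f y ^ 2 ∂P := by
          gcongr with i _; exact hv i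
      _ = (∫ y, f y ^ 2 ∂P) / n := by simp; field_simp
  · intro i _ j _ hij
    exact (hindep.indepFun hij).comp hf hf

/-- The relative error of the empirical variance of bounded centered i.i.d. variables is of
order `C / √(n σ²)` in mean. -/
lemma integral_abs_empVar_div_sub_one_le [IsProbabilityMeasure μ] [IsProbabilityMeasure P]
    (hlaw : ∀ i, HasLaw (X i) P μ) (hindep : iIndepFun X μ)
    {f : ℝ → ℝ} (hf : Measurable f) {C : ℝ} (hC : ∀ y, |f y| ≤ C) (hmean : ∫ y, f y ∂P = 0)
    (hpos : 0 < ∫ y, f y ^ 2 ∂P) {n : ℕ} (hn : n ≠ 0) :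
    Integrable (fun ω => |empVar n f (fun i => X i ω) / (∫ y, f y ^ 2 ∂P) - 1|) μ ∧
    ∫ ω, |empVar n f (fun i => X i ω) / (∫ y, f y ^ 2 ∂P) - 1| ∂μ
      ≤ 2 * (C / √(n * ∫ y, f y ^ 2 ∂P)) := by
  set s := ∫ y, f y ^ 2 ∂P with hs
  have hC0 : 0 ≤ C := (abs_nonneg _).trans (hC 0)
  have hn1 : (1 : ℝ) ≤ n := by exact_mod_cast Nat.one_le_iff_ne_zero.2 hn
  have hn' : (0 : ℝ) < n := by linarith
  have hX i := (hlaw i).aemeasurable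
  have hsq (y : ℝ) : f y ^ 2 ≤ C ^ 2 := by
    rw [← sq_abs]; exact pow_le_pow_left₀ (abs_nonneg _) (hC y) 2
  have hint2 : Integrable (fun y => f y ^ 2) P :=
    (memLp_of_bounded hf hC P 2).integrable_sq
  have hsC : s ≤ C ^ 2 := by
    calc s ≤ ∫ _, C ^ 2 ∂P := integral_mono hint2 (integrable_const _) hsq
      _ = C ^ 2 := by simp
  -- Normalized squares: `q` has mean 1 and `0 ≤ q ≤ C ^ 2 / s`, so its second moment is at most `C
  -- ^ 2 / s` and no fourth moment of `f` has to be tracked.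
  let q : ℝ → ℝ := fun y => f y ^ 2 / s
  have hq : Measurable q := (hf.pow_const 2).div_const s
  have hqC (y : ℝ) : |q y| ≤ C ^ 2 / s := by
    rw [abs_of_nonneg (by positivity)]
    exact div_le_div_of_nonneg_right (hsq y) hpos.le
  have hqmean : ∫ y, q y ∂P = 1 := by
    simp only [q]; rw [integral_div]; exact div_self hpos.ne'
  have hq2 : ∫ y, q y ^ 2 ∂P ≤ C ^ 2 / s := by
    calc ∫ y, q y ^ 2 ∂P ≤ ∫ y, C ^ 2 / s * q y ∂P := by
          refine integral_mono (memLp_of_bounded hq hqC P 2).integrable_sq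
            (((memLp_of_bounded hq hqC P 1).integrable le_rfl).const_mul _) fun y => ?_
          simp only [sq (q y)]
          exact mul_le_mul_of_nonneg_right ((le_abs_self _).trans (hqC y))
            (show 0 ≤ f y ^ 2 / s by positivity)
      _ = C ^ 2 / s := by rw [integral_const_mul, hqmean, mul_one]
  set U : Ω → ℝ := fun ω => avg n q (fun i => X i ω) - 1 with hU
  set S : Ω → ℝ := fun ω => avg n f (fun i => X i ω) with hS
  have hUm : MemLp U 2 μ := by
    refine MemLp.of_bound ((aemeasurable_avg hX hq n).sub_const 1).aestronglyMeasurable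
      (C ^ 2 / s + 1) (ae_of_all _ fun ω => ?_)
    refine (norm_sub_le _ _).trans ?_
    simpa using abs_avg_le hqC _
  have hSm : MemLp S 2 μ :=
    MemLp.of_bound (aemeasurable_avg hX hf n).aestronglyMeasurable C
      (ae_of_all _ fun ω => abs_avg_le hC _)
  have hU2 : ∫ ω, U ω ^ 2 ∂μ ≤ (C / √(n * s)) ^ 2 := by
    have := integral_sq_avg_sub_le hlaw hindep hq hqC hn
    rw [hqmean] at this
    refine this.trans ?_
    rw [div_pow, Real.sq_sqrt (by positivity)]
    calc _ ≤ C ^ 2 / s / n := by gcongr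
      _ = _ := by field_simp
  have hS2 : ∫ ω, S ω ^ 2 ∂μ ≤ s / n := by
    have := integral_sq_avg_sub_le hlaw hindep hf hC hn
    simpa [hmean] using this
  have hUabs : ∫ ω, |U ω| ∂μ ≤ C / √(n * s) := by
    refine abs_le_of_sq_le_sq' ?_ (by positivity) |>.2
    -- Nonnegativity of the variance of `|U|` is the inequality (E|U|)² ≤ E U².
    have hv := variance_nonneg (fun ω => |U ω|) μ
    rw [variance_eq_sub (show MemLp (fun ω => |U ω|) 2 μ from hUm.abs)] at hv
    simp only [Pi.pow_apply, sq_abs] at hv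
    linarith
  have heq (ω : Ω) : empVar n f (fun i => X i ω) / s - 1 = U ω - S ω ^ 2 / s := by
    rw [empVar_eq hn, hU, hS]
    simp only [q, avg, ← Finset.sum_div]
    ring
  have hle (ω : Ω) : |empVar n f (fun i => X i ω) / s - 1| ≤ |U ω| + S ω ^ 2 / s := by
    rw [heq]
    refine (abs_sub _ _).trans ?_
    rw [abs_of_nonneg (a := S ω ^ 2 / s) (by positivity)]
  have hdom : Integrable (fun ω => |U ω| + S ω ^ 2 / s) μ :=
    (hUm.integrable (by norm_num)).abs.add (hSm.integrable_sq.div_const s)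
  have hI : Integrable (fun ω => |empVar n f (fun i => X i ω) / s - 1|) μ := by
    simp_rw [heq]
    exact ((hUm.integrable (by norm_num)).sub (hSm.integrable_sq.div_const s)).abs
  refine ⟨hI, (integral_mono hI hdom hle).trans ?_⟩
  rw [integral_add (hUm.integrable (by norm_num)).abs (hSm.integrable_sq.div_const s),
    integral_div, two_mul]
  refine add_le_add hUabs ?_
  calc (∫ ω, S ω ^ 2 ∂μ) / s ≤ s / n / s := by gcongr
    _ = 1 / n := by field_simp
    -- The sample-mean correction is of smaller order: `s ≤ C ^ 2` and `1 ≤ n` give `n * s ≤ (C * n)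
    -- ^ 2`.
    _ ≤ C / √(n * s) := by
      rw [div_le_div_iff₀ hn' (by positivity), one_mul]
      refine Real.sqrt_le_iff.2 ⟨by positivity, ?_⟩
      rw [mul_pow]
      nlinarith [mul_le_mul hn1 hsC hpos.le hn'.le]

/-- Second order expansion of the characteristic function of a bounded centered variable. -/
lemma norm_charFun_map_sub_le [IsProbabilityMeasure P] {f : ℝ → ℝ} (hf : Measurable f) {C : ℝ}
    (hC : ∀ y, |f y| ≤ C) (hmean : ∫ y, f y ∂P = 0) {r : ℝ} (hr : |r| * C ≤ 1) :
    ‖charFun (P.map f) r - (1 - (r ^ 2 * ∫ y, f y ^ 2 ∂P : ℝ) / 2)‖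
      ≤ |r| ^ 3 * C * ∫ y, f y ^ 2 ∂P := by
  have hi1 : Integrable f P := (memLp_of_bounded hf hC P 1).integrable le_rfl
  have hi2 : Integrable (fun y => f y ^ 2) P := (memLp_of_bounded hf hC P 2).integrable_sq
  have hexp : Integrable (fun y => Complex.exp (r * f y * Complex.I)) P := by
    refine Integrable.of_bound (by fun_prop) 1 (ae_of_all _ fun y => ?_)
    rw [← Complex.ofReal_mul, Complex.norm_exp_ofReal_mul_I]
  have hpoly : Integrable
      (fun y => (1 : ℂ) + (r * Complex.I) * (f y : ℂ)
        - ((r ^ 2 / 2 : ℝ) : ℂ) * ((f y ^ 2 : ℝ) : ℂ))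
      P := ((integrable_const _).add (hi1.ofReal.const_mul _)).sub (hi2.ofReal.const_mul _)
  have heq : charFun (P.map f) r - (1 - (r ^ 2 * ∫ y, f y ^ 2 ∂P : ℝ) / 2)
      = ∫ y, (Complex.exp (r * f y * Complex.I)
        - (1 + (r * Complex.I) * (f y : ℂ) - ((r ^ 2 / 2 : ℝ) : ℂ) * ((f y ^ 2 : ℝ) : ℂ))) ∂P := by
    rw [integral_sub hexp hpoly, integral_sub, integral_add, integral_const_mul,
      integral_const_mul, integral_complex_ofReal, integral_complex_ofReal, hmean, charFun_apply_real,
      integral_map hf.aemeasurable (by fun_prop)]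
    · simp
      ring
    · exact integrable_const _
    · exact hi1.ofReal.const_mul _
    · exact (integrable_const _).add (hi1.ofReal.const_mul _)
    · exact hi2.ofReal.const_mul _
  rw [heq, ← integral_const_mul]
  refine norm_integral_le_of_norm_le (hi2.const_mul _) (ae_of_all _ fun y => ?_)
  have hz : ‖(r * f y * Complex.I : ℂ)‖ = |r| * |f y| := by simp
  have hrf : |r| * |f y| ≤ |r| * C := mul_le_mul_of_nonneg_left (hC y) (abs_nonneg _)
  -- Third-order Taylor remainder of the exponential, valid because the argument has norm at most 1.
  -- Its numerical constant is below 1 and is dropped at the end.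
  have hb := Complex.exp_bound (x := (r * f y * Complex.I : ℂ)) (by rw [hz]; linarith)
    (n := 3) (by norm_num)
  rw [hz] at hb
  simp only [Finset.sum_range_succ, Finset.sum_range_zero] at hb
  norm_num [Nat.factorial] at hb
  have hpe : (1 + r * f y * Complex.I + (r * f y * Complex.I) ^ 2 / 2 : ℂ)
      = 1 + (r * Complex.I) * (f y : ℂ) - ((r ^ 2 / 2 : ℝ) : ℂ) * ((f y ^ 2 : ℝ) : ℂ) := by
    push_cast
    linear_combination (r * f y : ℂ) ^ 2 / 2 * Complex.I_sq
  rw [hpe] at hb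
  refine hb.trans ?_
  have h3 : (|r| * |f y|) ^ 3 ≤ |r| ^ 3 * C * f y ^ 2 := by
    calc (|r| * |f y|) ^ 3 = |r| ^ 3 * |f y| * f y ^ 2 := by rw [← sq_abs (f y)]; ring
      _ ≤ |r| ^ 3 * C * f y ^ 2 := by gcongr; exact hC y
  have : 0 ≤ (|r| * |f y|) ^ 3 := by positivity
  linarith

/-- **Central limit theorem** for row-wise i.i.d. bounded arrays. -/
theorem tendstoInDistribution_avg [IsProbabilityMeasure μ] [IsProbabilityMeasure P]
    (hlaw : ∀ i, HasLaw (X i) P μ) (hindep : iIndepFun X μ)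
    {f : ℕ → ℝ → ℝ} (hf : ∀ n, Measurable (f n)) {C : ℕ → ℝ}
    (hC : ∀ᶠ n in atTop, ∀ y, |f n y| ≤ C n) (hmean : ∀ᶠ n in atTop, ∫ y, f n y ∂P = 0)
    (hpos : ∀ᶠ n in atTop, 0 < ∫ y, f n y ^ 2 ∂P)
    (hlim : Tendsto (fun n : ℕ => C n / √(n * ∫ y, f n y ^ 2 ∂P)) atTop (𝓝 0)) :
    TendstoInDistribution
      (fun (n : ℕ) ω => √n * avg n (f n) (fun i => X i ω) / √(∫ y, f n y ^ 2 ∂P))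
      atTop (id : ℝ → ℝ) (fun _ => μ) (gaussianReal 0 1) where
  forall_aemeasurable n :=
    ((aemeasurable_avg (fun i => (hlaw i).aemeasurable) (hf n) n).const_mul _).div_const _
  tendsto := by
    refine ProbabilityMeasure.tendsto_iff_tendsto_charFun.2 fun t => ?_
    simp only [ProbabilityMeasure.coe_mk, Measure.map_id, charFun_gaussianReal]
    set s : ℕ → ℝ := fun n => ∫ y, f n y ^ 2 ∂P with hs
    set φ : ℕ → ℂ := fun n => charFun (P.map (f n)) (t / √(n * s n)) with hφ
    have key : ∀ᶠ n : ℕ in atTop, φ n ^ n = charFun (μ.map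
        (fun ω => √n * avg n (f n) (fun i => X i ω) / √(s n))) t := by
      filter_upwards [eventually_ge_atTop 1] with n hn
      have hn' : (0 : ℝ) < n := by exact_mod_cast hn
      have hfun : (fun ω => √n * avg n (f n) (fun i => X i ω) / √(s n))
          = fun ω => (√n)⁻¹ * ∑ k ∈ Finset.range n, (√(s n))⁻¹ * f n (X k ω) := by
        ext ω
        rw [← Finset.mul_sum]
        simp only [avg]
        have : √(n : ℝ) * (1 / n) = (√n)⁻¹ := by
          have := Real.mul_self_sqrt hn'.le
          have h0 : √(n : ℝ) ≠ 0 := (Real.sqrt_pos.2 hn').ne'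
          field_simp
          linarith
        rw [← mul_assoc, this]
        ring
      have hident (i : ℕ) : IdentDistrib (fun ω => (√(s n))⁻¹ * f n (X i ω))
          (fun ω => (√(s n))⁻¹ * f n (X 0 ω)) μ μ :=
        IdentDistrib.comp (u := fun x => (√(s n))⁻¹ * f n x)
          ⟨(hlaw i).aemeasurable, (hlaw 0).aemeasurable, by rw [(hlaw i).map_eq, (hlaw 0).map_eq]⟩
          ((hf n).const_mul _)
      have hind : iIndepFun (fun i ω => (√(s n))⁻¹ * f n (X i ω)) μ :=
        hindep.comp (fun _ x => (√(s n))⁻¹ * f n x) fun _ => (hf n).const_mul _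
      rw [hfun, charFun_inv_sqrt_mul_sum hind hident]
      congr 1
      have hm : μ.map (fun ω => f n (X 0 ω)) = P.map (f n) := by
        rw [← (hlaw 0).map_eq, AEMeasurable.map_map_of_aemeasurable (hf n).aemeasurable
          (hlaw 0).aemeasurable]
        rfl
      have hcm : charFun (μ.map fun ω => (√(s n))⁻¹ * f n (X 0 ω)) ((√n)⁻¹ * t)
          = charFun (μ.map fun ω => f n (X 0 ω)) ((√(s n))⁻¹ * ((√n)⁻¹ * t)) :=
        charFun_map_mul_comp ((hf n).comp_aemeasurable (hlaw 0).aemeasurable) _ _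
      rw [hcm, hm]
      simp only [hφ]
      congr 1
      rw [Real.sqrt_mul hn'.le]
      field_simp
    refine Tendsto.congr' key ?_
    have hexp : Complex.exp (t * (0 : ℝ) * Complex.I - ((1 : NNReal) : ℝ) * t ^ 2 / 2)
        = Complex.exp (-(t ^ 2 / 2 : ℝ) : ℂ) := by
      congr 1; push_cast; ring
    rw [hexp]
    -- It suffices that the characteristic function of one summand is 1 - t²/(2n) + o(1/n).
    refine Complex.tendsto_pow_exp_of_isLittleO_sub_add_div _ ?_
    have hsmall : Tendsto (fun n : ℕ => |t| ^ 3 * (C n / √(n * s n))) atTop (𝓝 0) := by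
      simpa using hlim.const_mul (|t| ^ 3)
    have hle1 : ∀ᶠ n : ℕ in atTop, |t| * (C n / √(n * s n)) ≤ 1 := by
      have : Tendsto (fun n : ℕ => |t| * (C n / √(n * s n))) atTop (𝓝 0) := by
        simpa using hlim.const_mul |t|
      exact (this.eventually_lt_const one_pos).mono fun _ h => h.le
    refine Asymptotics.isLittleO_iff.2 fun c hc => ?_
    filter_upwards [eventually_ge_atTop 1, hC, hmean, hpos, hle1,
      hsmall.eventually_lt_const hc] with n hn hCn hmn hpn h1 h2
    have hn' : (0 : ℝ) < n := by exact_mod_cast hn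
    have hsn0 : s n ≠ 0 := hpn.ne'
    have hns : 0 < n * s n := mul_pos hn' hpn
    have hsq : √(n * s n) ^ 2 = n * s n := Real.sq_sqrt hns.le
    have hsp : 0 < √(n * s n) := Real.sqrt_pos.2 hns
    have habs : |t / √(n * s n)| = |t| / √(n * s n) := by rw [abs_div, abs_of_pos hsp]
    have hb := norm_charFun_map_sub_le (hf n) hCn hmn (r := t / √(n * s n))
      (by rw [habs]; refine le_of_eq_of_le ?_ h1; ring)
    have hsn : (∫ y, f n y ^ 2 ∂P) = s n := rfl
    rw [habs, hsn, div_pow, hsq] at hb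
    have e1 : (1 - ((t ^ 2 / (n * s n) * s n : ℝ) : ℂ) / 2) = 1 + (-(t ^ 2 / 2 : ℝ) : ℂ) / n := by
      have : t ^ 2 / (n * s n) * s n = t ^ 2 / n := by field_simp
      rw [this]; push_cast; ring
    rw [e1] at hb
    refine hb.trans ?_
    -- One factor of `n * s n` cancels the variance and leaves `1 / n`; the remaining square root
    -- forms the ratio assumed to vanish.
    have e2 : (|t| / √(n * s n)) ^ 3 * C n * s n = |t| ^ 3 * (C n / √(n * s n)) * (1 / n) := by
      rw [div_pow, pow_succ (√(n * s n)), hsq]; field_simp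
    rw [e2]
    simp only [norm_div, norm_one, Complex.norm_natCast]
    gcongr

end LocalL2

/-! ### Integrals of centered indicators: boundedness, mean and covariance. -/

namespace LocalL2

/-- The integral `∫ w(u) (1(y ≤ T u) - F(T u)) dν(u)` of the centered indicators at `y`. -/
noncomputable def infl (P ν : Measure ℝ) (w T : ℝ → ℝ) (y : ℝ) : ℝ :=
  ∫ u, w u * ((if y ≤ T u then 1 else 0) - cdf P (T u)) ∂ν

section Influence

variable {P ν : Measure ℝ} {w w' T : ℝ → ℝ}

lemma measurable_cdf (P : Measure ℝ) : Measurable (cdf P) := (monotone_cdf P).measurable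

lemma measurable_ite_le {α : Type*} [MeasurableSpace α] {a b : α → ℝ} (ha : Measurable a)
    (hb : Measurable b) : Measurable fun p => if a p ≤ b p then (1 : ℝ) else 0 :=
  Measurable.ite (measurableSet_le ha hb) measurable_const measurable_const

lemma abs_ite_sub_le {p : Prop} [Decidable p] {c : ℝ} (h0 : 0 ≤ c) (h1 : c ≤ 1) :
    |(if p then (1 : ℝ) else 0) - c| ≤ 1 := by
  rw [abs_le]; split_ifs <;> constructor <;> linarith

lemma abs_mul_ite_sub_cdf_le (a y z : ℝ) :
    ‖a * ((if y ≤ z then 1 else 0) - cdf P z)‖ ≤ ‖a‖ := by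
  rw [norm_mul]
  exact mul_le_of_le_one_right (norm_nonneg _) (abs_ite_sub_le (cdf_nonneg P z) (cdf_le_one P z))

lemma measurable_ite_sub_cdf (hT : Measurable T) :
    Measurable fun p : ℝ × ℝ => (if p.1 ≤ T p.2 then (1 : ℝ) else 0) - cdf P (T p.2) :=
  (measurable_ite_le measurable_fst (hT.comp measurable_snd)).sub
    ((measurable_cdf P).comp (hT.comp measurable_snd))

lemma measurable_infl [SFinite ν] (hw : Measurable w) (hT : Measurable T) :
    Measurable (infl P ν w T) := by
  refine StronglyMeasurable.measurable ?_
  refine StronglyMeasurable.integral_prod_right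
    (f := fun y u => w u * ((if y ≤ T u then 1 else 0) - cdf P (T u))) ?_
  exact ((hw.comp measurable_snd).mul (measurable_ite_sub_cdf hT)).stronglyMeasurable

lemma integrable_mul_ite_sub_cdf (hw : Integrable w ν) (hT : Measurable T) (y : ℝ) :
    Integrable (fun u => w u * ((if y ≤ T u then 1 else 0) - cdf P (T u))) ν :=
  hw.mono (hw.1.mul ((measurable_ite_le measurable_const hT).sub
    ((measurable_cdf P).comp hT)).aestronglyMeasurable)
    (ae_of_all _ fun _ => abs_mul_ite_sub_cdf_le _ _ _)

lemma abs_infl_le (hw : Integrable w ν) (y : ℝ) : |infl P ν w T y| ≤ ∫ u, |w u| ∂ν :=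
  norm_integral_le_of_norm_le hw.norm (ae_of_all _ fun _ => abs_mul_ite_sub_cdf_le _ _ _)

lemma empiricalCDF_nonneg (n : ℕ) (x : ℕ → ℝ) (u : ℝ) : 0 ≤ empiricalCDF n x u := by
  unfold empiricalCDF
  refine mul_nonneg (by positivity) (Finset.sum_nonneg fun i _ => ?_)
  split_ifs <;> simp

lemma empiricalCDF_le_one (n : ℕ) (x : ℕ → ℝ) (u : ℝ) : empiricalCDF n x u ≤ 1 := by
  refine (le_abs_self _).trans (abs_avg_le (n := n) (f := fun y => if y ≤ u then 1 else 0) ?_ x)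
  intro y
  split_ifs <;> simp

lemma measurable_empiricalCDF (n : ℕ) :
    Measurable fun p : (ℕ → ℝ) × ℝ => empiricalCDF n p.1 p.2 := by
  unfold empiricalCDF
  exact (Finset.measurable_fun_sum _ fun i _ =>
    measurable_ite_le ((measurable_pi_apply i).comp measurable_fst) measurable_snd).const_mul _

lemma avg_infl (hw : Integrable w ν) (hT : Measurable T) {n : ℕ} (hn : n ≠ 0) (x : ℕ → ℝ) :
    avg n (infl P ν w T) x = ∫ u, w u * (empiricalCDF n x (T u) - cdf P (T u)) ∂ν := by
  have hn' : (n : ℝ) ≠ 0 := by exact_mod_cast hn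
  unfold avg infl
  rw [← integral_finsetSum _ fun i _ => integrable_mul_ite_sub_cdf hw hT _, ← integral_const_mul]
  congr 1
  ext u
  unfold empiricalCDF
  rw [← Finset.mul_sum, Finset.sum_sub_distrib]
  simp
  field_simp

lemma integrable_mul_empiricalCDF_sub (hw : Integrable w ν) (hT : Measurable T) (n : ℕ)
    (x : ℕ → ℝ) : Integrable (fun u => w u * (empiricalCDF n x (T u) - cdf P (T u))) ν := by
  have hm : Measurable fun u => empiricalCDF n x (T u) - cdf P (T u) :=
    ((measurable_empiricalCDF n).comp (measurable_const.prodMk hT)).sub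
      ((measurable_cdf P).comp hT)
  refine hw.mul_bdd (c := 1) hm.aestronglyMeasurable (ae_of_all _ fun u => ?_)
  rw [Real.norm_eq_abs, abs_le]
  have h1 := empiricalCDF_nonneg n x (T u)
  have h2 := empiricalCDF_le_one n x (T u)
  have h3 := cdf_nonneg P (T u)
  have h4 := cdf_le_one P (T u)
  constructor <;> linarith

/-- Since F̂ - F is the average of the centered indicators, integrating it against `w` gives the
sample mean of `infl`. This is what turns the plug-in estimator into an empirical variance. -/
lemma integral_mul_ite_sub_empiricalCDF (hw : Integrable w ν) (hT : Measurable T) {n : ℕ}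
    (hn : n ≠ 0) (x : ℕ → ℝ) (y : ℝ) :
    ∫ u, w u * ((if y ≤ T u then 1 else 0) - empiricalCDF n x (T u)) ∂ν
      = infl P ν w T y - avg n (infl P ν w T) x := by
  rw [avg_infl hw hT hn, infl, ← integral_sub (integrable_mul_ite_sub_cdf hw hT y)
    (integrable_mul_empiricalCDF_sub hw hT n x)]
  congr 1
  ext u
  ring

variable [IsProbabilityMeasure P]

lemma integrable_ite_le (P : Measure ℝ) [IsProbabilityMeasure P] (z : ℝ) :
    Integrable (fun y => if y ≤ z then (1 : ℝ) else 0) P := by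
  refine Integrable.of_bound (measurable_ite_le measurable_id
    measurable_const).aestronglyMeasurable 1 (ae_of_all _ fun y => ?_)
  split_ifs <;> simp

lemma integral_ite_le (P : Measure ℝ) [IsProbabilityMeasure P] (z : ℝ) :
    ∫ y, (if y ≤ z then (1 : ℝ) else 0) ∂P = cdf P z := by
  rw [cdf_eq_real, ← integral_indicator_one measurableSet_Iic]
  congr 1

lemma integral_ite_sub_cdf (z : ℝ) : ∫ y, ((if y ≤ z then (1 : ℝ) else 0) - cdf P z) ∂P = 0 := by
  rw [integral_sub (integrable_ite_le P z) (integrable_const _), integral_ite_le]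
  simp

lemma integral_ite_sub_cdf_mul (a b : ℝ) :
    ∫ y, ((if y ≤ a then (1 : ℝ) else 0) - cdf P a) * ((if y ≤ b then (1 : ℝ) else 0) - cdf P b) ∂P
      = cdf P (min a b) - cdf P a * cdf P b := by
  have h (y : ℝ) : ((if y ≤ a then (1 : ℝ) else 0) - cdf P a)
      * ((if y ≤ b then (1 : ℝ) else 0) - cdf P b)
      = ((if y ≤ min a b then (1 : ℝ) else 0) - cdf P b * (if y ≤ a then (1 : ℝ) else 0))
        - cdf P a * ((if y ≤ b then (1 : ℝ) else 0) - cdf P b) := by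
    by_cases h1 : y ≤ a <;> by_cases h2 : y ≤ b <;> simp [h1, h2] <;> ring
  simp_rw [h]
  rw [integral_sub, integral_sub (integrable_ite_le P _) ((integrable_ite_le P _).const_mul _),
    integral_const_mul, integral_const_mul, integral_ite_le, integral_ite_le, integral_ite_sub_cdf]
  · ring
  · exact (integrable_ite_le P _).sub ((integrable_ite_le P _).const_mul _)
  · exact ((integrable_ite_le P _).sub (integrable_const _)).const_mul _

lemma integral_infl [SFinite ν] (hw : Integrable w ν) (hT : Measurable T) :
    ∫ y, infl P ν w T y ∂P = 0 := by
  unfold infl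
  rw [integral_integral_swap]
  · simp_rw [integral_const_mul, integral_ite_sub_cdf, mul_zero, integral_zero]
  · have h := hw.comp_snd P
    exact h.mono (h.1.mul (measurable_ite_sub_cdf hT).aestronglyMeasurable)
      (ae_of_all _ fun _ => abs_mul_ite_sub_cdf_le _ _ _)

/-- Fubini: the product is a double integral over `ν.prod ν`, and integrating out `y` first leaves
the covariance of two indicators, `integral_ite_sub_cdf_mul`. Integrability comes from that of the
weights, as the centered indicators are bounded by 1. -/
lemma integral_infl_mul_infl [SFinite ν] (hw : Integrable w ν) (hw' : Integrable w' ν)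
    (hT : Measurable T) :
    ∫ y, infl P ν w T y * infl P ν w' T y ∂P
      = ∫ v, ∫ u, w u * w' v * (cdf P (min (T u) (T v)) - cdf P (T u) * cdf P (T v)) ∂ν ∂ν := by
  let r : ℝ → ℝ → ℝ := fun y u => (if y ≤ T u then 1 else 0) - cdf P (T u)
  have hww : Integrable (fun p : ℝ × ℝ => w' p.1 * w p.2) (ν.prod ν) := hw'.mul_prod hw
  have h1 (y : ℝ) : infl P ν w T y * infl P ν w' T y
      = ∫ p : ℝ × ℝ, (w' p.1 * r y p.1) * (w p.2 * r y p.2) ∂(ν.prod ν) := by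
    rw [integral_prod_mul (fun v => w' v * r y v) (fun u => w u * r y u), mul_comm]
    rfl
  simp_rw [h1]
  have hr (y u : ℝ) : ‖r y u‖ ≤ 1 := abs_ite_sub_le (cdf_nonneg P _) (cdf_le_one P _)
  have hrm : Measurable fun p : ℝ × ℝ => r p.1 p.2 := measurable_ite_sub_cdf hT
  rw [integral_integral_swap]
  · have h2 (p : ℝ × ℝ) : ∫ y, (w' p.1 * r y p.1) * (w p.2 * r y p.2) ∂P
        = w p.2 * w' p.1 * (cdf P (min (T p.2) (T p.1)) - cdf P (T p.2) * cdf P (T p.1)) := by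
      rw [← integral_ite_sub_cdf_mul, ← integral_const_mul]
      refine integral_congr_ae (ae_of_all _ fun y => ?_)
      simp only [r]; ring
    simp_rw [h2]
    refine integral_prod _ ?_
    have hcm : Measurable fun p : ℝ × ℝ =>
        cdf P (min (T p.2) (T p.1)) - cdf P (T p.2) * cdf P (T p.1) := by
      have := measurable_cdf P
      fun_prop
    refine hww.mono (AEStronglyMeasurable.mul (hww.1.congr (ae_of_all _ fun p => mul_comm _ _))
      hcm.aestronglyMeasurable) (ae_of_all _ fun p => ?_)
    rw [norm_mul, mul_comm (w p.2)]
    refine mul_le_of_le_one_right (norm_nonneg _) ?_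
    rw [← integral_ite_sub_cdf_mul]
    refine (norm_integral_le_of_norm_le (integrable_const (1 : ℝ)) (ae_of_all _ fun y => ?_)).trans
      (by simp)
    exact (norm_mul_le _ _).trans (mul_le_one₀ (hr _ _) (norm_nonneg _) (hr _ _))
  · have h := hww.comp_snd P
    have hm : Measurable fun q : ℝ × ℝ × ℝ => r q.1 q.2.1 * r q.1 q.2.2 :=
      (hrm.comp (measurable_fst.prodMk measurable_snd.fst)).mul
        (hrm.comp (measurable_fst.prodMk measurable_snd.snd))
    refine (h.mul_bdd (c := 1) hm.aestronglyMeasurable (ae_of_all _ fun q => ?_)).congr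
      (ae_of_all _ fun q => ?_)
    · exact (norm_mul_le _ _).trans (mul_le_one₀ (hr _ _) (norm_nonneg _) (hr _ _))
    · simp only [Function.uncurry]; ring

end Influence

end LocalL2

/-! ### Influence functions of the local coefficients; the two variance matrices as covariance
matrices. -/

namespace LocalL2

/-- Lebesgue measure on the rescaled support. -/
noncomputable def locVol (P : Measure ℝ) (x₀ h : ℝ) : Measure ℝ :=
  volume.restrict (rescaledSupport P x₀ h)

instance (P : Measure ℝ) (x₀ h : ℝ) : SFinite (locVol P x₀ h) := by
  unfold locVol; infer_instance

variable {d : ℕ} {P : Measure ℝ} {R υ : ℝ → Fin d → ℝ} {K g : ℝ → ℝ} {x₀ h : ℝ}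

/-- The weights `R_j(u) K(u) g(x₀ + h u)`. -/
def wt (R : ℝ → Fin d → ℝ) (K g : ℝ → ℝ) (x₀ h : ℝ) (j : Fin d) (u : ℝ) : ℝ :=
  R u j * K u * g (x₀ + h * u)

/-- The influence function of the `j`-th local coefficient. -/
noncomputable def influence (P : Measure ℝ) (R : ℝ → Fin d → ℝ) (K g : ℝ → ℝ) (x₀ h : ℝ) (j : Fin d) :
    ℝ → ℝ :=
  infl P (locVol P x₀ h) (wt R K g x₀ h j) (fun u => x₀ + h * u)

/-- The linear combination `Σ_j b_j ψ_j` of the influence functions. -/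
noncomputable def lin (P : Measure ℝ) (R : ℝ → Fin d → ℝ) (K g : ℝ → ℝ) (x₀ h : ℝ) (b : Fin d → ℝ)
    (y : ℝ) : ℝ :=
  ∑ j, b j * influence P R K g x₀ h j y

lemma measurable_rescale (x₀ h : ℝ) : Measurable fun u : ℝ => x₀ + h * u := by fun_prop

lemma measurable_wt (hR : Measurable R) (hK : Measurable K) (hg : Measurable g) (j : Fin d) :
    Measurable (wt R K g x₀ h j) :=
  (((measurable_pi_apply j).comp hR).mul hK).mul (hg.comp (measurable_rescale x₀ h))

lemma measurable_influence (hR : Measurable R) (hK : Measurable K) (hg : Measurable g) (j : Fin d) :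
    Measurable (influence P R K g x₀ h j) :=
  measurable_infl (measurable_wt hR hK hg j) (measurable_rescale x₀ h)

lemma measurable_lin (hR : Measurable R) (hK : Measurable K) (hg : Measurable g)
    (b : Fin d → ℝ) : Measurable (lin P R K g x₀ h b) :=
  Finset.measurable_fun_sum _ fun j _ => (measurable_influence hR hK hg j).const_mul _

/-- A crude bound with factor `d` is enough. What matters is homogeneity in `b`, since later
directions depend on the bandwidth. -/
lemma abs_dotProduct_le (b x : Fin d → ℝ) {M : ℝ} (hM : ∀ j, |x j| ≤ M) :
    |b ⬝ᵥ x| ≤ √(b ⬝ᵥ b) * (d * M) := by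
  have hb (j : Fin d) : |b j| ≤ √(b ⬝ᵥ b) := by
    refine Real.abs_le_sqrt ?_
    rw [sq]
    exact Finset.single_le_sum (f := fun i => b i * b i) (fun _ _ => mul_self_nonneg _)
      (Finset.mem_univ j)
  calc |b ⬝ᵥ x| ≤ ∑ j, |b j * x j| := Finset.abs_sum_le_sum_abs _ _
    _ ≤ ∑ _j : Fin d, √(b ⬝ᵥ b) * M := Finset.sum_le_sum fun j _ => by
        rw [abs_mul]
        exact mul_le_mul (hb j) (hM j) (abs_nonneg _) (Real.sqrt_nonneg _)
    _ = √(b ⬝ᵥ b) * (d * M) := by simp; ring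

lemma dotProduct_self_pos {b : Fin d → ℝ} (hb : b ≠ 0) : 0 < b ⬝ᵥ b :=
  lt_of_le_of_ne (Finset.sum_nonneg fun _ _ => mul_self_nonneg _)
    (fun h0 => hb (dotProduct_self_eq_zero.1 h0.symm))

lemma dotProduct_mulVec_eq_sum (M : Matrix (Fin d) (Fin d) ℝ) (b : Fin d → ℝ) :
    b ⬝ᵥ M *ᵥ b = ∑ j, ∑ k, b j * b k * M j k := by
  simp only [dotProduct, Matrix.mulVec, Finset.mul_sum]
  exact Finset.sum_congr rfl fun j _ => Finset.sum_congr rfl fun k _ => by ring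

lemma abs_influence_le {C : ℝ} (hw : ∀ j, Integrable (wt R K g x₀ h j) (locVol P x₀ h))
    (hC : ∀ j, ∫ u, |wt R K g x₀ h j u| ∂(locVol P x₀ h) ≤ C) (j : Fin d) (y : ℝ) :
    |influence P R K g x₀ h j y| ≤ C :=
  (abs_infl_le (hw j) y).trans (hC j)

lemma abs_lin_le {C : ℝ} (hw : ∀ j, Integrable (wt R K g x₀ h j) (locVol P x₀ h))
    (hC : ∀ j, ∫ u, |wt R K g x₀ h j u| ∂(locVol P x₀ h) ≤ C) (b : Fin d → ℝ) (y : ℝ) :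
    |lin P R K g x₀ h b y| ≤ √(b ⬝ᵥ b) * (d * C) :=
  abs_dotProduct_le b (fun j => influence P R K g x₀ h j y) fun j => abs_influence_le hw hC j y

section Moments

variable [IsProbabilityMeasure P]

lemma integrable_influence (hR : Measurable R) (hK : Measurable K) (hg : Measurable g)
    (hw : ∀ j, Integrable (wt R K g x₀ h j) (locVol P x₀ h)) (j : Fin d) :
    Integrable (influence P R K g x₀ h j) P :=
  Integrable.of_bound (measurable_influence hR hK hg j).aestronglyMeasurable _
    (ae_of_all _ (abs_infl_le (hw j)))

lemma integrable_influence_mul (hR : Measurable R) (hK : Measurable K) (hg : Measurable g)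
    (hw : ∀ j, Integrable (wt R K g x₀ h j) (locVol P x₀ h)) (j k : Fin d) :
    Integrable (fun y => influence P R K g x₀ h j y * influence P R K g x₀ h k y) P :=
  (integrable_influence hR hK hg hw j).mul_bdd (measurable_influence hR hK hg k).aestronglyMeasurable
    (ae_of_all _ (abs_infl_le (hw k)))

lemma integral_lin (hR : Measurable R) (hK : Measurable K) (hg : Measurable g)
    (hw : ∀ j, Integrable (wt R K g x₀ h j) (locVol P x₀ h)) (b : Fin d → ℝ) :
    ∫ y, lin P R K g x₀ h b y ∂P = 0 := by
  unfold lin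
  rw [integral_finsetSum _ fun j _ => (integrable_influence hR hK hg hw j).const_mul _]
  refine Finset.sum_eq_zero fun j _ => ?_
  rw [integral_const_mul, influence, integral_infl (hw j) (measurable_rescale x₀ h), mul_zero]

lemma Sig_apply (hh : 0 < h) (hw : ∀ j, Integrable (wt R K g x₀ h j) (locVol P x₀ h))
    (j k : Fin d) :
    Sig P R K g x₀ h j k = ∫ y, influence P R K g x₀ h j y * influence P R K g x₀ h k y ∂P := by
  unfold influence
  rw [integral_infl_mul_infl (hw j) (hw k) (measurable_rescale x₀ h)]
  simp only [Sig, Matrix.of_apply, locVol]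
  congr 1; ext v; congr 1; ext u
  have hmin : x₀ + h * min u v = min (x₀ + h * u) (x₀ + h * v) := by
    rw [mul_min_of_nonneg _ _ hh.le, min_add_add_left]
  rw [hmin]
  unfold wt
  ring

lemma dotProduct_Sig (hR : Measurable R) (hK : Measurable K) (hg : Measurable g) (hh : 0 < h)
    (hw : ∀ j, Integrable (wt R K g x₀ h j) (locVol P x₀ h)) (b : Fin d → ℝ) :
    b ⬝ᵥ Sig P R K g x₀ h *ᵥ b = ∫ y, lin P R K g x₀ h b y ^ 2 ∂P := by
  rw [dotProduct_mulVec_eq_sum]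
  have hsq (y : ℝ) : lin P R K g x₀ h b y ^ 2
      = ∑ j, ∑ k, b j * b k * (influence P R K g x₀ h j y * influence P R K g x₀ h k y) := by
    rw [sq, lin, Finset.sum_mul_sum]
    exact Finset.sum_congr rfl fun j _ => Finset.sum_congr rfl fun k _ => by ring
  simp_rw [hsq]
  have hi (j k : Fin d) := (integrable_influence_mul hR hK hg hw j k).const_mul (b j * b k)
  rw [integral_finsetSum _ fun j _ => integrable_finsetSum _ fun k _ => hi j k]
  refine Finset.sum_congr rfl fun j _ => ?_
  rw [integral_finsetSum _ fun k _ => hi j k]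
  refine Finset.sum_congr rfl fun k _ => ?_
  rw [integral_const_mul, Sig_apply hh hw]

lemma isHermitian_Sig (hh : 0 < h) (hw : ∀ j, Integrable (wt R K g x₀ h j) (locVol P x₀ h)) :
    (Sig P R K g x₀ h).IsHermitian := by
  ext j k
  simp only [Matrix.conjTranspose_apply, star_trivial]
  rw [Sig_apply hh hw, Sig_apply hh hw]
  simp_rw [mul_comm]

end Moments

/-- The integral of the `j`-th weight against the indicators centered at the empirical distribution
function. -/
noncomputable def empComp (P : Measure ℝ) (R : ℝ → Fin d → ℝ) (K g : ℝ → ℝ) (x₀ h : ℝ) (n : ℕ)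
    (j : Fin d) (y : ℝ) (x : ℕ → ℝ) : ℝ :=
  ∫ u, wt R K g x₀ h j u * ((if y ≤ x₀ + h * u then 1 else 0) - empiricalCDF n x (x₀ + h * u))
    ∂(locVol P x₀ h)

lemma SigHat_apply (n : ℕ) (x : ℕ → ℝ) (j k : Fin d) :
    SigHat P R K g x₀ h n x j k
      = avg n (fun y => empComp P R K g x₀ h n j y x * empComp P R K g x₀ h n k y x) x := by
  simp only [SigHat, Matrix.of_apply, avg]
  congr 1
  refine Finset.sum_congr rfl fun i _ => ?_
  rw [mul_comm (empComp _ _ _ _ _ _ _ _ _ _)]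
  unfold empComp
  rw [← integral_mul_const, locVol]
  congr 1; ext v
  rw [← integral_const_mul]
  congr 1; ext u
  unfold wt
  ring

lemma measurable_empComp (hR : Measurable R) (hK : Measurable K) (hg : Measurable g) (n : ℕ)
    (j : Fin d) : Measurable fun p : ℝ × (ℕ → ℝ) => empComp P R K g x₀ h n j p.1 p.2 := by
  refine StronglyMeasurable.measurable ?_
  refine StronglyMeasurable.integral_prod_right (f := fun (p : ℝ × (ℕ → ℝ)) u =>
    wt R K g x₀ h j u * ((if p.1 ≤ x₀ + h * u then 1 else 0)
      - empiricalCDF n p.2 (x₀ + h * u))) ?_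
  have hT : Measurable fun q : (ℝ × (ℕ → ℝ)) × ℝ => x₀ + h * q.2 :=
    (measurable_rescale x₀ h).comp measurable_snd
  exact (((measurable_wt hR hK hg j).comp measurable_snd).mul
    ((measurable_ite_le measurable_fst.fst hT).sub
      ((measurable_empiricalCDF n).comp (measurable_fst.snd.prodMk hT)))).stronglyMeasurable

lemma measurable_SigHat (hR : Measurable R) (hK : Measurable K) (hg : Measurable g) (n : ℕ)
    (j k : Fin d) : Measurable fun x => SigHat P R K g x₀ h n x j k := by
  simp_rw [SigHat_apply, avg]
  refine (Finset.measurable_fun_sum _ fun i _ => ?_).const_mul _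
  have hp : Measurable fun x : ℕ → ℝ => (x i, x) := (measurable_pi_apply i).prodMk measurable_id
  exact ((measurable_empComp hR hK hg n j).comp hp).mul ((measurable_empComp hR hK hg n k).comp hp)

/-- An exact identity: `empComp` is the influence function minus its sample mean, so the quadratic
form expands into the average squared deviation of `lin`. -/
lemma dotProduct_SigHat (hw : ∀ j, Integrable (wt R K g x₀ h j) (locVol P x₀ h))
    {n : ℕ} (hn : n ≠ 0) (x : ℕ → ℝ) (b : Fin d → ℝ) :
    b ⬝ᵥ SigHat P R K g x₀ h n x *ᵥ b = empVar n (lin P R K g x₀ h b) x := by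
  rw [dotProduct_mulVec_eq_sum]
  have hav : avg n (lin P R K g x₀ h b) x = ∑ j, b j * avg n (influence P R K g x₀ h j) x := by
    simp only [avg, lin, Finset.mul_sum]
    rw [Finset.sum_comm]
    exact Finset.sum_congr rfl fun j _ => Finset.sum_congr rfl fun i _ => by ring
  have he (j : Fin d) (y : ℝ) : empComp P R K g x₀ h n j y x
      = influence P R K g x₀ h j y - avg n (influence P R K g x₀ h j) x :=
    integral_mul_ite_sub_empiricalCDF (hw j) (measurable_rescale x₀ h) hn x y
  have hl (y : ℝ) : (lin P R K g x₀ h b y - avg n (lin P R K g x₀ h b) x) ^ 2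
      = ∑ j, ∑ k, b j * b k * (empComp P R K g x₀ h n j y x * empComp P R K g x₀ h n k y x) := by
    rw [hav, lin, ← Finset.sum_sub_distrib, sq, Finset.sum_mul_sum]
    exact Finset.sum_congr rfl fun j _ => Finset.sum_congr rfl fun k _ => by rw [he, he]; ring
  unfold empVar
  simp_rw [hl, SigHat_apply, avg]
  rw [Finset.sum_comm, Finset.mul_sum]
  simp_rw [Finset.mul_sum]
  rw [Finset.sum_comm]
  simp_rw [Finset.sum_comm (s := Finset.range n)]
  rw [Finset.sum_comm]
  refine Finset.sum_congr rfl fun j _ => Finset.sum_congr rfl fun k _ =>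
    Finset.sum_congr rfl fun i _ => by ring

/-! ### Eigenvalue bounds and bounds uniform in the bandwidth. -/

/-- A symmetric matrix with eigenvalues at least `ε` has a quadratic form at least `ε b'b`. -/
lemma EigenvaluesGE.le_dotProduct {M : Matrix (Fin d) (Fin d) ℝ} {ε : ℝ} (hM : EigenvaluesGE M ε)
    (hs : M.IsHermitian) (b : Fin d → ℝ) : ε * (b ⬝ᵥ b) ≤ b ⬝ᵥ M *ᵥ b := by
  have hN : (M - ε • (1 : Matrix (Fin d) (Fin d) ℝ)).IsHermitian :=
    hs.sub (by rw [Matrix.IsHermitian, Matrix.conjTranspose_smul]; simp)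
  -- An eigenvalue `l` of the shifted matrix gives the eigenvalue `l + ε` of `M`, hence `0 ≤ l`.
  have hpsd : (M - ε • (1 : Matrix (Fin d) (Fin d) ℝ)).PosSemidef := by
    rw [hN.posSemidef_iff_eigenvalues_nonneg]
    intro i
    have hv := hN.mulVec_eigenvectorBasis i
    set v := (hN.eigenvectorBasis i).ofLp with hvdef
    have hv0 : v ≠ 0 := by
      intro h0
      have := hN.eigenvectorBasis.orthonormal.ne_zero i
      exact this (by ext k; exact congrFun h0 k)
    have hMv : M *ᵥ v = (hN.eigenvalues i + ε) • v := by
      rw [Matrix.sub_mulVec, Matrix.smul_mulVec, Matrix.one_mulVec, sub_eq_iff_eq_add] at hv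
      rw [hv, add_smul]
    have := hM (hN.eigenvalues i + ε)
      (Module.End.hasEigenvalue_of_hasEigenvector (x := v)
        ⟨Module.End.mem_eigenspace_iff.2 (by rw [Matrix.toLin'_apply, hMv]), hv0⟩)
    simpa using this
  have h0 := hpsd.dotProduct_mulVec_nonneg b
  simp only [star_trivial, Matrix.sub_mulVec, Matrix.smul_mulVec, Matrix.one_mulVec,
    dotProduct_sub, dotProduct_smul, smul_eq_mul] at h0
  linarith

lemma EigenvaluesGE.det_ne_zero {M : Matrix (Fin d) (Fin d) ℝ} {ε : ℝ} (hM : EigenvaluesGE M ε)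
    (hε : 0 < ε) : M.det ≠ 0 := by
  intro h0
  obtain ⟨v, hv, hMv⟩ := Matrix.exists_mulVec_eq_zero_iff.2 h0
  have := hM 0 (Module.End.hasEigenvalue_of_hasEigenvector (x := v)
    ⟨Module.End.mem_eigenspace_iff.2 (by rw [Matrix.toLin'_apply, hMv, zero_smul]), hv⟩)
  linarith

lemma isSymm_Gam : (Gam P R K g x₀ h).IsSymm := by
  ext j k
  simp only [Gam, Matrix.transpose_apply, Matrix.of_apply]
  congr 1; ext u; ring

lemma integrable_locVol_of_bound {f : ℝ → ℝ} (hf : Measurable f) {C : ℝ}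
    (hC : ∀ u ∈ Icc (-1 : ℝ) 1, |f u| ≤ C) (h0 : ∀ u ∉ Icc (-1 : ℝ) 1, f u = 0) :
    Integrable f (locVol P x₀ h) ∧ ∫ u, |f u| ∂(locVol P x₀ h) ≤ 2 * C := by
  have hdom : Integrable (indicator (Icc (-1 : ℝ) 1) fun _ => C) volume :=
    (integrable_indicator_iff measurableSet_Icc).2 (integrableOn_const (by simp))
  have hle (u : ℝ) : ‖f u‖ ≤ indicator (Icc (-1 : ℝ) 1) (fun _ => C) u := by
    by_cases hu : u ∈ Icc (-1 : ℝ) 1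
    · rw [indicator_of_mem hu]; exact hC u hu
    · rw [indicator_of_notMem hu, h0 u hu, norm_zero]
  have hfi : Integrable f volume := hdom.mono' hf.aestronglyMeasurable (ae_of_all _ hle)
  refine ⟨hfi.restrict, ?_⟩
  calc ∫ u, |f u| ∂(locVol P x₀ h) ≤ ∫ u, |f u| :=
        setIntegral_le_integral hfi.norm (ae_of_all _ fun u => abs_nonneg _)
    _ ≤ ∫ u, indicator (Icc (-1 : ℝ) 1) (fun _ => C) u := integral_mono hfi.norm hdom hle
    _ = 2 * C := by
      rw [integral_indicator measurableSet_Icc]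
      simp
      norm_num

lemma IsKernel.eq_zero (hK : IsKernel K) {u : ℝ} (hu : u ∉ Icc (-1 : ℝ) 1) : K u = 0 := by
  rw [← hK.tsupport_eq] at hu
  exact image_eq_zero_of_notMem_tsupport hu

lemma IsKernel.measurable (hK : IsKernel K) : Measurable K := by
  have : K = indicator (Icc (-1 : ℝ) 1) K := by
    ext u
    by_cases hu : u ∈ Icc (-1 : ℝ) 1
    · rw [indicator_of_mem hu]
    · rw [indicator_of_notMem hu, hK.eq_zero hu]
  rw [this, ← piecewise_eq_indicator]
  have h1 := hK.continuousOn.measurable_piecewise (g := fun _ => (0 : ℝ)) continuousOn_const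
    measurableSet_Icc
  exact h1

lemma IsKernel.exists_bound (hK : IsKernel K) : ∃ C, 0 ≤ C ∧ ∀ u, |K u| ≤ C := by
  obtain ⟨C, hC⟩ := isCompact_Icc.exists_bound_of_continuousOn hK.continuousOn
  refine ⟨max C 0, le_max_right _ _, fun u => ?_⟩
  by_cases hu : u ∈ Icc (-1 : ℝ) 1
  · exact (hC u hu).trans (le_max_left _ _)
  · rw [hK.eq_zero hu, abs_zero]; exact le_max_right _ _

/-- A nonnegative local density is locally bounded. -/
lemma HasLocalDensity.exists_bound {H : ℝ → ℝ} {δ : ℝ} (hH : HasLocalDensity H g x₀ δ)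
    (h0 : ∀ y ∈ Icc (x₀ - δ) (x₀ + δ), 0 ≤ g y) :
    ∃ C, ∀ y ∈ Icc (x₀ - δ) (x₀ + δ), |g y| ≤ C := by
  obtain ⟨-, -, pm, pp, dpm, dpp, ⟨Cm, hCm⟩, ⟨Cp, hCp⟩⟩ := hH
  -- One bound per side, plus the value at `x₀`, which neither one-sided expansion controls. The
  -- expansions bound `g` only from above; nonnegativity supplies the other direction.
  refine ⟨max |g x₀| (max (|pm| + δ * |dpm| + |Cm| * δ ^ 2) (|pp| + δ * |dpp| + |Cp| * δ ^ 2)),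
    fun y hy => ?_⟩
  have key (u p dp C : ℝ) (hu0 : u ≠ 0) (hu : |u| ≤ δ)
      (hle : (g (x₀ + u) - p - u * dp) / u ^ 2 ≤ C) :
      g (x₀ + u) ≤ |p| + δ * |dp| + |C| * δ ^ 2 := by
    have hu2 : 0 < u ^ 2 := by positivity
    rw [div_le_iff₀ hu2] at hle
    have h1 : u * dp ≤ δ * |dp| := by
      refine (le_abs_self _).trans ?_
      rw [abs_mul]
      exact mul_le_mul_of_nonneg_right hu (abs_nonneg _)
    have h2 : C * u ^ 2 ≤ |C| * δ ^ 2 := by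
      rw [← sq_abs u]
      exact mul_le_mul (le_abs_self _) (pow_le_pow_left₀ (abs_nonneg _) hu 2) (by positivity)
        (abs_nonneg _)
    linarith [le_abs_self p]
  obtain ⟨hy1, hy2⟩ := hy
  rw [abs_of_nonneg (h0 y ⟨hy1, hy2⟩)]
  rcases lt_trichotomy y x₀ with hlt | rfl | hgt
  · have := key (y - x₀) pm dpm Cm (sub_ne_zero.2 hlt.ne)
      (abs_le.2 ⟨by linarith, by linarith⟩)
      (hCm ⟨y - x₀, ⟨by linarith, by linarith⟩, rfl⟩)
    rw [add_sub_cancel] at this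
    exact this.trans ((le_max_left _ _).trans (le_max_right _ _))
  · exact (le_abs_self _).trans (le_max_left _ _)
  · have := key (y - x₀) pp dpp Cp (sub_ne_zero.2 hgt.ne')
      (abs_le.2 ⟨by linarith, by linarith⟩)
      (hCp ⟨y - x₀, ⟨by linarith, by linarith⟩, rfl⟩)
    rw [add_sub_cancel] at this
    exact this.trans ((le_max_right _ _).trans (le_max_right _ _))

lemma rescale_mem_Icc {δ u : ℝ} (hh : 0 < h) (hδ : h ≤ δ) (hu : u ∈ Icc (-1 : ℝ) 1) :
    x₀ + h * u ∈ Icc (x₀ - δ) (x₀ + δ) := by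
  obtain ⟨h1, h2⟩ := hu
  constructor <;> nlinarith

/-- The weights are integrable, with integrals bounded uniformly in small bandwidths. -/
lemma exists_bound_integral_wt (hK : IsKernel K) (hR : IsScalableBasis R υ) (hg : Measurable g)
    {δ Cg : ℝ} (hCg : ∀ y ∈ Icc (x₀ - δ) (x₀ + δ), |g y| ≤ Cg) :
    ∃ C, 0 ≤ C ∧ ∀ h, 0 < h → h ≤ δ → ∀ j, Integrable (wt R K g x₀ h j) (locVol P x₀ h) ∧
      ∫ u, |wt R K g x₀ h j u| ∂(locVol P x₀ h) ≤ C := by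
  obtain ⟨CK, hCK0, hCK⟩ := hK.exists_bound
  obtain ⟨CR, hCR⟩ := hR.locallyBounded 1
  refine ⟨2 * (|CR| * CK * |Cg|), by positivity, fun h hh hδ j => ?_⟩
  refine integrable_locVol_of_bound (measurable_wt hR.measurable hK.measurable hg j) ?_ ?_
  · intro u hu
    unfold wt
    rw [abs_mul, abs_mul]
    have h1 : |R u j| ≤ |CR| := (hCR u (abs_le.2 hu) j).trans (le_abs_self _)
    have h2 : |g (x₀ + h * u)| ≤ |Cg| := (hCg _ (rescale_mem_Icc hh hδ hu)).trans (le_abs_self _)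
    gcongr
    exact hCK u
  · intro u hu
    simp [wt, hK.eq_zero hu]

end LocalL2

/-! ### From dG to a Lebesgue density, and the normal equations. -/

namespace LocalL2

variable {d : ℕ} {P : Measure ℝ} {R υ : ℝ → Fin d → ℝ} {K g : ℝ → ℝ} {x₀ h δ : ℝ}
  {G : StieltjesFunction ℝ}

/-- Where `G` is absolutely continuous with derivative `g`, its measure has density `g`. -/
lemma restrict_measure_eq_withDensity (hg0 : ∀ y ∈ Icc (x₀ - δ) (x₀ + δ), 0 ≤ g y)
    (hG : HasLocalDensity G g x₀ δ) (hδ : 0 < δ) :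
    G.measure.restrict (Ioc (x₀ - δ) (x₀ + δ))
      = (volume.withDensity fun y => ENNReal.ofReal (g y)).restrict (Ioc (x₀ - δ) (x₀ + δ)) := by
  set a := x₀ - δ with ha
  set b := x₀ + δ with hb
  have hab : a ≤ b := by linarith
  -- Half-open intervals determine the measure. After clipping to the window, the increment of `G`
  -- is the integral of its derivative by absolute continuity.
  refine Measure.ext_of_Ioc _ _ fun s t _ => ?_
  rw [Measure.restrict_apply measurableSet_Ioc, Measure.restrict_apply measurableSet_Ioc,
    Ioc_inter_Ioc, StieltjesFunction.measure_Ioc, withDensity_apply _ measurableSet_Ioc]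
  set s' := max s a
  set t' := min t b
  rcases le_or_gt t' s' with hts | hst
  · rw [Ioc_eq_empty (not_lt.2 hts), ENNReal.ofReal_of_nonpos (sub_nonpos.2 (G.mono hts))]
    simp
  have hs' : a ≤ s' := le_max_right _ _
  have ht' : t' ≤ b := min_le_right _ _
  have hsub : Ioc s' t' ⊆ Icc a b := fun y hy => ⟨hs'.trans hy.1.le, hy.2.trans ht'⟩
  have hac : AbsolutelyContinuousOnInterval G s' t' := by
    refine hG.1.mono ?_
    rw [uIcc_of_le hst.le, uIcc_of_le hab]
    exact Icc_subset_Icc hs' ht'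
  have hae : ∀ᵐ y ∂(volume.restrict (Ioc s' t')), deriv G y = g y := by
    rw [ae_restrict_iff' measurableSet_Ioc]
    filter_upwards [hG.2.1] with y hy hmem
    exact (hy (hsub hmem)).deriv
  have hint : IntegrableOn g (Ioc s' t') := by
    have := (intervalIntegrable_iff_integrableOn_Ioc_of_le hst.le).1 hac.intervalIntegrable_deriv
    exact this.congr hae
  rw [← hac.integral_deriv_eq_sub, intervalIntegral.integral_of_le hst.le,
    integral_congr_ae hae, ofReal_integral_eq_lintegral_ofReal hint]
  exact (ae_restrict_iff' measurableSet_Ioc).2 (ae_of_all _ fun y hy => hg0 y (hsub hy))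

lemma setIntegral_measure_eq (hg : Measurable g)
    (hg0 : ∀ y ∈ Icc (x₀ - δ) (x₀ + δ), 0 ≤ g y) (hG : HasLocalDensity G g x₀ δ) (hδ : 0 < δ)
    {S : Set ℝ} (hS : MeasurableSet S) {φ : ℝ → ℝ}
    (hφ : ∀ y ∉ Ioc (x₀ - δ) (x₀ + δ), φ y = 0) :
    ∫ y in S, φ y ∂G.measure = ∫ y in S, φ y * g y := by
  set I := Ioc (x₀ - δ) (x₀ + δ) with hI
  have hIm : MeasurableSet I := measurableSet_Ioc
  have hz (ψ : ℝ → ℝ) (hψ : ∀ y ∉ I, ψ y = 0) (m : Measure ℝ) :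
      ∫ y in S, ψ y ∂m = ∫ y in S ∩ I, ψ y ∂m :=
    (setIntegral_eq_of_subset_of_forall_sdiff_eq_zero hS inter_subset_left
      fun y hy => hψ y fun hyI => hy.2 ⟨hy.1, hyI⟩)
  rw [hz φ hφ, hz (fun y => φ y * g y) fun y hy => by rw [hφ y hy, zero_mul],
    ← Measure.restrict_restrict hS, restrict_measure_eq_withDensity hg0 hG hδ,
    Measure.restrict_restrict hS,
    setIntegral_withDensity_eq_setIntegral_toReal_smul hg.ennreal_ofReal
      (ae_of_all _ fun _ => ENNReal.ofReal_lt_top) _ (hS.inter hIm)]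
  refine setIntegral_congr_fun (hS.inter hIm) fun y hy => ?_
  have : 0 ≤ g y := hg0 y (Ioc_subset_Icc_self hy.2)
  simp only [ENNReal.toReal_ofReal this, smul_eq_mul]
  ring

lemma setIntegral_rescale (hh : 0 < h) {S : Set ℝ} (hS : MeasurableSet S) (ψ : ℝ → ℝ) :
    ∫ u in S, ψ u = h * ∫ v in {v | x₀ + h * v ∈ S}, ψ (x₀ + h * v) := by
  have hS' : MeasurableSet {v | x₀ + h * v ∈ S} := measurable_rescale x₀ h hS
  rw [← integral_indicator hS, ← integral_indicator hS']
  have h1 : (indicator {v | x₀ + h * v ∈ S} fun v => ψ (x₀ + h * v))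
      = fun v => (fun w => indicator S ψ (x₀ + w)) (h * v) := by
    ext v
    by_cases hv : x₀ + h * v ∈ S <;> simp [hv]
  rw [h1, Measure.integral_comp_mul_left, integral_add_left_eq_self (indicator S ψ) x₀,
    abs_of_pos (inv_pos.2 hh), smul_eq_mul, mul_inv_cancel_left₀ hh.ne']

/-- The kernel-weighted integral against `dG` in rescaled coordinates. -/
lemma setIntegral_kernel_measure_eq (hK : IsKernel K) (hg : Measurable g)
    (hg0 : ∀ y ∈ Icc (x₀ - δ) (x₀ + δ), 0 ≤ g y) (hG : HasLocalDensity G g x₀ δ)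
    (hh : 0 < h) (hhδ : h < δ) (φ : ℝ → ℝ) :
    ∫ u in P.support, φ u * ((1 / h) * K ((u - x₀) / h)) ∂G.measure
      = ∫ v, φ (x₀ + h * v) * (K v * g (x₀ + h * v)) ∂(locVol P x₀ h) := by
  have hS : MeasurableSet P.support := Measure.isClosed_support.measurableSet
  rw [setIntegral_measure_eq hg hg0 hG (hh.trans hhδ) hS, setIntegral_rescale (x₀ := x₀) hh hS,
    ← integral_const_mul]
  · refine integral_congr_ae (ae_of_all _ fun v => ?_)
    simp only [add_sub_cancel_left, mul_div_cancel_left₀ v hh.ne']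
    field_simp
  · intro y hy
    rw [hK.eq_zero, mul_zero, mul_zero]
    rintro ⟨h1, h2⟩
    rw [le_div_iff₀ hh] at h1
    rw [div_le_iff₀ hh] at h2
    exact hy ⟨by linarith, by linarith⟩

/-- The quadratic has no constant term, so its discriminant is `4 * A ^ 2`, which must be
nonpositive. -/
lemma eq_zero_of_forall_quadratic_nonneg {A B : ℝ} (h : ∀ t : ℝ, 0 ≤ t ^ 2 * B - 2 * t * A) :
    A = 0 := by
  have := discrim_le_zero (a := B) (b := -(2 * A)) (c := 0) fun t => by
    have := h t
    linarith
  unfold discrim at this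
  nlinarith [sq_nonneg A]

/-- Normal equation of a weighted least squares problem along the direction `q`. -/
lemma integral_mul_eq_zero_of_forall_le {ν : Measure ℝ} {p q κ : ℝ → ℝ}
    (hpp : Integrable (fun v => p v ^ 2 * κ v) ν) (hpq : Integrable (fun v => p v * q v * κ v) ν)
    (hqq : Integrable (fun v => q v ^ 2 * κ v) ν)
    (hmin : ∀ t : ℝ, ∫ v, p v ^ 2 * κ v ∂ν ≤ ∫ v, (p v - t * q v) ^ 2 * κ v ∂ν) :
    ∫ v, p v * q v * κ v ∂ν = 0 := by
  refine eq_zero_of_forall_quadratic_nonneg (B := ∫ v, q v ^ 2 * κ v ∂ν) fun t => ?_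
  have h := hmin t
  have he : ∀ v, (p v - t * q v) ^ 2 * κ v
      = p v ^ 2 * κ v - 2 * t * (p v * q v * κ v) + t ^ 2 * (q v ^ 2 * κ v) := fun v => by ring
  simp_rw [he] at h
  have hs : Integrable (fun v => p v ^ 2 * κ v - 2 * t * (p v * q v * κ v)) ν :=
    hpp.sub (hpq.const_mul _)
  rw [integral_add hs (hqq.const_mul _),
    integral_sub hpp (hpq.const_mul _), integral_const_mul, integral_const_mul] at h
  linarith

/-- The bias terms `∫ R_j(v) [F(x₀ + h v) - R(h v)'θ] K(v) g(x₀ + h v) dv`. -/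
noncomputable def bias (P : Measure ℝ) (R : ℝ → Fin d → ℝ) (K g : ℝ → ℝ) (x₀ h : ℝ)
    (θ : Fin d → ℝ) (j : Fin d) : ℝ :=
  ∫ v, wt R K g x₀ h j v * (cdf P (x₀ + h * v) - R (h * v) ⬝ᵥ θ) ∂(locVol P x₀ h)

lemma IsScalableBasis.mul_apply (hR : IsScalableBasis R υ) (hh : 0 < h) (v : ℝ) (j : Fin d) :
    υ h j * R (h * v) j = R v j := by
  have := congrFun (hR.scale_eq h hh (h * v)) j
  rwa [Matrix.mulVec_diagonal, mul_div_cancel_left₀ v hh.ne'] at this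

lemma IsScalableBasis.bounded_rescale (hR : IsScalableBasis R υ) (hh : 0 < h) :
    ∃ C, 0 ≤ C ∧ ∀ v ∈ Icc (-1 : ℝ) 1, ∀ j, |R (h * v) j| ≤ C := by
  obtain ⟨C, hC⟩ := hR.locallyBounded h
  refine ⟨max C 0, le_max_right _ _, fun v hv j => (hC _ ?_ j).trans (le_max_left _ _)⟩
  rw [abs_mul, abs_of_pos hh]
  exact mul_le_of_le_one_right hh.le (abs_le.2 hv)

lemma measurable_dotProduct_rescale (hR : Measurable R) (θ : Fin d → ℝ) :
    Measurable fun v => R (h * v) ⬝ᵥ θ := by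
  simp only [dotProduct]
  refine Finset.measurable_fun_sum _ fun j _ => Measurable.mul_const ?_ _
  exact (measurable_pi_apply j).comp (hR.comp (measurable_const_mul h))

lemma abs_dotProduct_le' {θ x : Fin d → ℝ} {C : ℝ} (hx : ∀ j, |x j| ≤ C) :
    |x ⬝ᵥ θ| ≤ √(θ ⬝ᵥ θ) * (d * C) := by
  rw [dotProduct_comm]; exact abs_dotProduct_le θ x hx

/-- Local boundedness of `R` makes the set of errors bounded above, so the real `sSup` is a genuine
supremum. -/
lemma abs_cdf_sub_le_approxError (hR : IsScalableBasis R υ) (θ : Fin d → ℝ) {y : ℝ}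
    (hy : |y - x₀| ≤ h) : |cdf P y - R (y - x₀) ⬝ᵥ θ| ≤ approxError P R x₀ θ h := by
  refine le_csSup ?_ ⟨y, hy, rfl⟩
  obtain ⟨C, hC⟩ := hR.locallyBounded h
  refine ⟨1 + √(θ ⬝ᵥ θ) * (d * C), ?_⟩
  rintro _ ⟨z, hz, rfl⟩
  refine (abs_sub _ _).trans (add_le_add ?_ (abs_dotProduct_le' (hC _ hz)))
  rw [abs_of_nonneg (cdf_nonneg P z)]
  exact cdf_le_one P z

lemma approxError_nonneg (θ : Fin d → ℝ) : 0 ≤ approxError P R x₀ θ h := by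
  refine Real.sSup_nonneg ?_
  rintro _ ⟨y, -, rfl⟩
  exact abs_nonneg _

/-- The kernel vanishes unless `|v| ≤ 1`, where `x₀ + h * v` lies within `h` of `x₀` and the
approximation error applies pointwise. -/
lemma abs_bias_le {C : ℝ} (hK : IsKernel K) (hR : IsScalableBasis R υ) (hh : 0 < h)
    (hw : ∀ j, Integrable (wt R K g x₀ h j) (locVol P x₀ h))
    (hC : ∀ j, ∫ u, |wt R K g x₀ h j u| ∂(locVol P x₀ h) ≤ C) (θ : Fin d → ℝ) (j : Fin d) :
    |bias P R K g x₀ h θ j| ≤ C * approxError P R x₀ θ h := by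
  have hle (v : ℝ) : ‖wt R K g x₀ h j v * (cdf P (x₀ + h * v) - R (h * v) ⬝ᵥ θ)‖
      ≤ ‖wt R K g x₀ h j v‖ * approxError P R x₀ θ h := by
    rw [norm_mul]
    by_cases hv : v ∈ Icc (-1 : ℝ) 1
    · refine mul_le_mul_of_nonneg_left ?_ (norm_nonneg _)
      have := abs_cdf_sub_le_approxError (P := P) (x₀ := x₀) (y := x₀ + h * v) hR θ (h := h) (by
        rw [add_sub_cancel_left, abs_mul, abs_of_pos hh]
        exact mul_le_of_le_one_right hh.le (abs_le.2 hv))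
      rwa [add_sub_cancel_left] at this
    · simp [wt, hK.eq_zero hv]
  refine (norm_integral_le_of_norm_le ((hw j).norm.mul_const _) (ae_of_all _ hle)).trans ?_
  rw [integral_mul_const]
  exact mul_le_mul_of_nonneg_right (hC j) (approxError_nonneg θ)

/-- The normal equations of the local `L²` criterion. -/
lemma integral_wt_mul_residual_eq_zero (hK : IsKernel K) (hR : IsScalableBasis R υ)
    (hg : Measurable g) (hg0 : ∀ y ∈ Icc (x₀ - δ) (x₀ + δ), 0 ≤ g y)
    (hG : HasLocalDensity G g x₀ δ) (hh : 0 < h) (hhδ : h < δ) {n : ℕ} {x : ℕ → ℝ}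
    {ϑ : Fin d → ℝ} (hmin : IsMinOn (criterion P R K G x₀ h n x) univ ϑ) :
    ∀ j, ∫ v, wt R K g x₀ h j v * (empiricalCDF n x (x₀ + h * v) - R (h * v) ⬝ᵥ ϑ)
      ∂(locVol P x₀ h) = 0 := by
  obtain ⟨Cg, hCg⟩ := hG.exists_bound hg0
  obtain ⟨CK, hCK0, hCK⟩ := hK.exists_bound
  obtain ⟨CR, hCR0, hCR⟩ := hR.bounded_rescale hh
  set κ : ℝ → ℝ := fun v => K v * g (x₀ + h * v) with hκ
  have hκm : Measurable κ := hK.measurable.mul (hg.comp (measurable_rescale x₀ h))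
  have hκb : ∀ v ∈ Icc (-1 : ℝ) 1, |κ v| ≤ CK * |Cg| := fun v hv => by
    rw [hκ, abs_mul]
    exact mul_le_mul (hCK v) ((hCg _ (rescale_mem_Icc hh hhδ.le hv)).trans (le_abs_self _))
      (abs_nonneg _) hCK0
  have hκ0 : ∀ v ∉ Icc (-1 : ℝ) 1, κ v = 0 := fun v hv => by simp [hκ, hK.eq_zero hv]
  have hint {m m' : ℝ → ℝ} (hm : Measurable m) (hm' : Measurable m') {C C' : ℝ} (hC0 : 0 ≤ C)
      (hC : ∀ v ∈ Icc (-1 : ℝ) 1, |m v| ≤ C) (hC' : ∀ v ∈ Icc (-1 : ℝ) 1, |m' v| ≤ C') :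
      Integrable (fun v => m v * m' v * κ v) (locVol P x₀ h) := by
    refine (integrable_locVol_of_bound ((hm.mul hm').mul hκm) (C := C * C' * (CK * |Cg|)) ?_ ?_).1
    · intro v hv
      change |m v * m' v * κ v| ≤ _
      rw [abs_mul, abs_mul]
      have h2 := hC' v hv
      have h3 : 0 ≤ C' := (abs_nonneg _).trans h2
      exact mul_le_mul (mul_le_mul (hC v hv) h2 (abs_nonneg _) hC0) (hκb v hv) (abs_nonneg _)
        (by positivity)
    · intro v hv
      change m v * m' v * κ v = 0
      rw [hκ0 v hv, mul_zero]
  have hcrit (t : Fin d → ℝ) : criterion P R K G x₀ h n x t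
      = ∫ v, (empiricalCDF n x (x₀ + h * v) - R (h * v) ⬝ᵥ t) ^ 2 * κ v ∂(locVol P x₀ h) := by
    unfold criterion
    rw [setIntegral_kernel_measure_eq hK hg hg0 hG hh hhδ
      (fun u => (empiricalCDF n x u - R (u - x₀) ⬝ᵥ t) ^ 2)]
    simp only [add_sub_cancel_left]
    rfl
  intro j
  set p : ℝ → ℝ := fun v => empiricalCDF n x (x₀ + h * v) - R (h * v) ⬝ᵥ ϑ with hp
  set q : ℝ → ℝ := fun v => R (h * v) j with hq
  have hpm : Measurable p :=
    ((measurable_empiricalCDF n).comp (measurable_const.prodMk (measurable_rescale x₀ h))).sub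
      (measurable_dotProduct_rescale hR.measurable ϑ)
  have hqm : Measurable q := (measurable_pi_apply j).comp
    (hR.measurable.comp (measurable_const_mul h))
  have hpb : ∀ v ∈ Icc (-1 : ℝ) 1, |p v| ≤ 1 + √(ϑ ⬝ᵥ ϑ) * (d * CR) := fun v hv => by
    refine (abs_sub _ _).trans (add_le_add ?_ (abs_dotProduct_le' (hCR v hv)))
    rw [abs_of_nonneg (empiricalCDF_nonneg _ _ _)]
    exact empiricalCDF_le_one _ _ _
  have hqb : ∀ v ∈ Icc (-1 : ℝ) 1, |q v| ≤ CR := fun v hv => hCR v hv j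
  have hp0 : 0 ≤ 1 + √(ϑ ⬝ᵥ ϑ) * (d * CR) := by positivity
  have hkey : ∫ v, p v * q v * κ v ∂(locVol P x₀ h) = 0 := by
    refine integral_mul_eq_zero_of_forall_le ?_ (hint hpm hqm hp0 hpb hqb) ?_ fun t => ?_
    · simpa only [sq] using hint hpm hpm hp0 hpb hpb
    · simpa only [sq] using hint hqm hqm hCR0 hqb hqb
    -- Perturbing the `j`-th coefficient by `t` changes the residual `p` to `p - t * q`.
    · have hle := isMinOn_iff.1 hmin (ϑ + t • Pi.single j 1) (mem_univ _)
      rw [hcrit, hcrit] at hle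
      refine hle.trans_eq ?_
      refine integral_congr_ae (ae_of_all _ fun v => ?_)
      simp only [hp, hq, dotProduct_add, dotProduct_smul, dotProduct_single_one, smul_eq_mul]
      ring
  have hw (v : ℝ) : wt R K g x₀ h j v * p v = υ h j * (p v * q v * κ v) := by
    simp only [wt, hq, hκ, ← hR.mul_apply hh v j]
    ring
  change ∫ v, wt R K g x₀ h j v * p v ∂(locVol P x₀ h) = 0
  simp_rw [hw]
  rw [integral_const_mul, hkey, mul_zero]

/-- The estimation error is a linear function of the empirical averages and the bias. -/
lemma dotProduct_sub_eq (hK : IsKernel K) (hR : IsScalableBasis R υ)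
    (hg : Measurable g) (hg0 : ∀ y ∈ Icc (x₀ - δ) (x₀ + δ), 0 ≤ g y)
    (hG : HasLocalDensity G g x₀ δ) (hh : 0 < h) (hhδ : h < δ)
    (hw : ∀ j, Integrable (wt R K g x₀ h j) (locVol P x₀ h))
    (hdet : (Gam P R K g x₀ h).det ≠ 0) {n : ℕ} (hn : n ≠ 0) {x : ℕ → ℝ}
    {ϑ : Fin d → ℝ} (hmin : IsMinOn (criterion P R K G x₀ h n x) univ ϑ) (θ c : Fin d → ℝ) :
    c ⬝ᵥ (ϑ - θ) = avg n (lin P R K g x₀ h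
        ((Gam P R K g x₀ h)⁻¹ *ᵥ (Matrix.diagonal (υ h) *ᵥ c))) x
      + ((Gam P R K g x₀ h)⁻¹ *ᵥ (Matrix.diagonal (υ h) *ᵥ c)) ⬝ᵥ bias P R K g x₀ h θ := by
  have hnorm := integral_wt_mul_residual_eq_zero hK hR hg hg0 hG hh hhδ hmin
  obtain ⟨CR, hCR0, hCR⟩ := hR.bounded_rescale hh
  set Γ := Gam P R K g x₀ h with hΓ
  set a := Γ⁻¹ *ᵥ (Matrix.diagonal (υ h) *ᵥ c) with ha
  set ν := locVol P x₀ h with hν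
  -- The error in rescaled coordinates: the scaling property gives R(hv)'(ϑ - θ) = R(v)'Δ, which is
  -- why `Γ` acts on `Δ`.
  let Δ : Fin d → ℝ := fun k => (ϑ - θ) k / υ h k
  have hυ (k : Fin d) : υ h k ≠ 0 := (hR.scale_pos h hh k).ne'
  have hT := measurable_rescale x₀ h
  have hdp {m : ℝ → ℝ} (hm : Measurable m) {C : ℝ} (hC : ∀ v ∈ Icc (-1 : ℝ) 1, |m v| ≤ C)
      (j : Fin d) : Integrable (fun v => wt R K g x₀ h j v * m v) ν := by
    -- `m` is bounded only on `[-1, 1]`; truncating it there costs nothing because the weight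
    -- vanishes outside.
    have h1 : (fun v => wt R K g x₀ h j v * m v)
        = fun v => wt R K g x₀ h j v * indicator (Icc (-1 : ℝ) 1) m v := by
      ext v
      by_cases hv : v ∈ Icc (-1 : ℝ) 1
      · rw [indicator_of_mem hv]
      · simp [wt, hK.eq_zero hv]
    rw [h1]
    refine (hw j).mul_bdd (c := |C|) (hm.indicator measurableSet_Icc).aestronglyMeasurable
      (ae_of_all _ fun v => ?_)
    by_cases hv : v ∈ Icc (-1 : ℝ) 1
    · rw [indicator_of_mem hv]; exact (hC v hv).trans (le_abs_self _)
    · rw [indicator_of_notMem hv, norm_zero]; exact abs_nonneg _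
  have hdot (t : Fin d → ℝ) (j : Fin d) :
      Integrable (fun v => wt R K g x₀ h j v * (R (h * v) ⬝ᵥ t)) ν :=
    hdp (measurable_dotProduct_rescale hR.measurable t)
      (fun v hv => abs_dotProduct_le' (hCR v hv)) j
  have hcdf (j : Fin d) : Integrable (fun v => wt R K g x₀ h j v * cdf P (x₀ + h * v)) ν :=
    hdp (m := fun v => cdf P (x₀ + h * v)) ((measurable_cdf P).comp hT) (C := 1) (fun v _ => by
      rw [abs_of_nonneg (cdf_nonneg P _)]; exact cdf_le_one P _) j
  have hGd (j : Fin d) : (Γ *ᵥ Δ) j = ∫ v, wt R K g x₀ h j v * (R (h * v) ⬝ᵥ (ϑ - θ)) ∂ν := by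
    have hsum (v : ℝ) : wt R K g x₀ h j v * (R (h * v) ⬝ᵥ (ϑ - θ))
        = ∑ k, wt R K g x₀ h j v * R v k * Δ k := by
      rw [dotProduct, Finset.mul_sum]
      refine Finset.sum_congr rfl fun k _ => ?_
      simp only [Δ, ← hR.mul_apply hh v k]
      have := hυ k
      field_simp
    simp_rw [hsum]
    obtain ⟨C1, hC1⟩ := hR.locallyBounded 1
    have hi (k : Fin d) : Integrable (fun v => wt R K g x₀ h j v * R v k) ν :=
      hdp (m := fun v => R v k) ((measurable_pi_apply k).comp hR.measurable)
        (fun v hv => hC1 v (abs_le.2 hv) k) j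
    rw [integral_finsetSum _ fun k _ => (hi k).mul_const _]
    simp only [Matrix.mulVec, dotProduct]
    refine Finset.sum_congr rfl fun k _ => ?_
    rw [integral_mul_const]
    congr 1
    simp only [hΓ, Gam, Matrix.of_apply, hν, locVol]
    congr 1; ext v; unfold wt; ring
  have hΓΔ : Γ *ᵥ Δ = (fun j => avg n (influence P R K g x₀ h j) x) + bias P R K g x₀ h θ := by
    ext j
    have hemp := integrable_mul_empiricalCDF_sub (P := P) (hw j) hT n x
    have hres : Integrable (fun v => wt R K g x₀ h j v
        * (cdf P (x₀ + h * v) - R (h * v) ⬝ᵥ θ)) ν := by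
      simp_rw [mul_sub]
      exact (hcdf j).sub (hdot θ j)
    have hsum : Integrable (fun v => wt R K g x₀ h j v
        * (empiricalCDF n x (x₀ + h * v) - cdf P (x₀ + h * v))
        + wt R K g x₀ h j v * (cdf P (x₀ + h * v) - R (h * v) ⬝ᵥ θ)) ν := hemp.add hres
    -- The two sides differ by the normal equation: F̂ - R'ϑ = (F̂ - F) + (F - R'θ) - R'(ϑ - θ)
    -- integrates to zero against the weight.
    rw [Pi.add_apply, hGd, influence, avg_infl (hw j) hT hn, bias, ← integral_add hemp hres,
      ← sub_eq_zero, ← integral_sub (hdot _ j) hsum, ← neg_eq_zero, ← integral_neg,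
      ← hnorm j]
    refine integral_congr_ae (ae_of_all _ fun v => ?_)
    simp only [dotProduct_sub]
    ring
  have hlin : avg n (lin P R K g x₀ h a) x = a ⬝ᵥ fun j => avg n (influence P R K g x₀ h j) x := by
    simp only [avg, lin, dotProduct, Finset.mul_sum]
    rw [Finset.sum_comm]
    exact Finset.sum_congr rfl fun j _ => Finset.sum_congr rfl fun i _ => by ring
  rw [hlin, ← dotProduct_add, ← hΓΔ, Matrix.dotProduct_mulVec, ← Matrix.mulVec_transpose,
    isSymm_Gam.eq, ha, Matrix.mulVec_mulVec, Matrix.mul_nonsing_inv _ (isUnit_iff_ne_zero.2 hdet),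
    Matrix.one_mulVec]
  simp only [dotProduct, Matrix.mulVec_diagonal, Δ]
  refine Finset.sum_congr rfl fun k _ => ?_
  have := hυ k
  field_simp

end LocalL2

/-! ### Rates at small bandwidths and the two limit theorems. -/

namespace LocalL2

variable {d : ℕ} {P : Measure ℝ} {R υ : ℝ → Fin d → ℝ} {K g : ℝ → ℝ} {x₀ : ℝ}
  {G : StieltjesFunction ℝ} {Ω : Type*} [MeasurableSpace Ω] {μ : Measure Ω} {X : ℕ → Ω → ℝ}
  {h : ℕ → ℝ}

/-- The consequences of the assumptions at a small bandwidth `h`: integrable weights with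
integrals at most `C`, nonsingular `Γ_h` and nondegenerate variance. -/
structure GoodBandwidth (P : Measure ℝ) (R : ℝ → Fin d → ℝ) (K g : ℝ → ℝ) (x₀ δ C ε h : ℝ) :
    Prop where
  lt : h < δ
  integrable : ∀ j, Integrable (wt R K g x₀ h j) (locVol P x₀ h)
  integral_le : ∀ j, ∫ u, |wt R K g x₀ h j u| ∂(locVol P x₀ h) ≤ C
  det_ne_zero : (Gam P R K g x₀ h).det ≠ 0
  variance_ge : ∀ b : Fin d → ℝ, ε * h * (b ⬝ᵥ b) ≤ ∫ y, lin P R K g x₀ h b y ^ 2 ∂P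

lemma eventually_goodBandwidth [IsProbabilityMeasure P] (hdgp : DGPAssumption P R υ K g x₀)
    (hdesign : DesignAssumption G g x₀) (hpos : ∀ n, 0 < h n) (hzero : Tendsto h atTop (𝓝 0)) :
    ∃ δ C ε : ℝ, 0 ≤ C ∧ 0 < ε ∧ HasLocalDensity G g x₀ δ ∧
      (∀ y ∈ Icc (x₀ - δ) (x₀ + δ), 0 ≤ g y) ∧
      ∀ᶠ n in atTop, GoodBandwidth P R K g x₀ δ C ε (h n) := by
  obtain ⟨δ, hδ, hG, hg0⟩ := hdesign.smooth
  obtain ⟨Cg, hCg⟩ := hG.exists_bound hg0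
  obtain ⟨C, hC0, hC⟩ := exists_bound_integral_wt (P := P) hdgp.kernel hdgp.basis
    hdesign.measurable hCg
  obtain ⟨ε, hε, heig⟩ := hdgp.eigenvalues
  refine ⟨δ, C, ε, hC0, hε, hG, hg0, ?_⟩
  have hlim : Tendsto h atTop (𝓝[>] 0) :=
    tendsto_nhdsWithin_iff.2 ⟨hzero, Eventually.of_forall hpos⟩
  filter_upwards [hlim.eventually heig, hzero.eventually_lt_const hδ] with n hn hlt
  have hw j := (hC (h n) (hpos n) hlt.le j).1
  refine ⟨hlt, hw, fun j => (hC (h n) (hpos n) hlt.le j).2, hn.1.det_ne_zero hε, fun b => ?_⟩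
  have hs : ((h n)⁻¹ • Sig P R K g x₀ (h n)).IsHermitian := by
    have := isHermitian_Sig (hpos n) hw
    rw [Matrix.IsHermitian, Matrix.conjTranspose_smul, this.eq, star_trivial]
  have hq := hn.2.le_dotProduct hs b
  rw [Matrix.smul_mulVec, dotProduct_smul, smul_eq_mul, dotProduct_Sig hdgp.basis.measurable
    hdgp.kernel.measurable hdesign.measurable (hpos n) hw, inv_mul_eq_div,
    le_div_iff₀ (hpos n)] at hq
  linarith

lemma GoodBandwidth.variance_pos {δ C ε h : ℝ} (H : GoodBandwidth P R K g x₀ δ C ε h) (hε : 0 < ε)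
    (hh : 0 < h) {b : Fin d → ℝ} (hb : b ≠ 0) : 0 < ∫ y, lin P R K g x₀ h b y ^ 2 ∂P :=
  (mul_pos (mul_pos hε hh) (dotProduct_self_pos hb)).trans_le (H.variance_ge b)

/-- The norm of `b` cancels against the lower bound on the variance. The right side is therefore
free of `b`, and the estimate survives directions that move with `h`. -/
lemma GoodBandwidth.norm_div_sqrt_le {δ C ε h : ℝ} (H : GoodBandwidth P R K g x₀ δ C ε h)
    (hε : 0 < ε) (hh : 0 < h) {b : Fin d → ℝ} (hb : b ≠ 0) :
    √(b ⬝ᵥ b) / √(∫ y, lin P R K g x₀ h b y ^ 2 ∂P) ≤ 1 / √ε * √(1 / h) := by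
  have hbb := dotProduct_self_pos hb
  have hεh : 0 < ε * h := mul_pos hε hh
  calc √(b ⬝ᵥ b) / √(∫ y, lin P R K g x₀ h b y ^ 2 ∂P)
      ≤ √(b ⬝ᵥ b) / √(ε * h * (b ⬝ᵥ b)) :=
        div_le_div_of_nonneg_left (Real.sqrt_nonneg _) (Real.sqrt_pos.2 (by positivity))
          (Real.sqrt_le_sqrt (H.variance_ge b))
    _ = 1 / √ε * √(1 / h) := by
      rw [Real.sqrt_mul hεh.le, Real.sqrt_mul hε.le, Real.sqrt_div zero_le_one, Real.sqrt_one]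
      have := (Real.sqrt_pos.2 hbb).ne'
      field_simp

lemma GoodBandwidth.ratio_le {δ C ε h : ℝ} (H : GoodBandwidth P R K g x₀ δ C ε h) (hC : 0 ≤ C)
    (hε : 0 < ε) (hh : 0 < h) {b : Fin d → ℝ} (hb : b ≠ 0) (n : ℕ) :
    √(b ⬝ᵥ b) * (d * C) / √(n * ∫ y, lin P R K g x₀ h b y ^ 2 ∂P)
      ≤ d * C / √ε * √(1 / (n * h)) := by
  rw [Real.sqrt_mul (Nat.cast_nonneg n)]
  calc _ = d * C / √n * (√(b ⬝ᵥ b) / √(∫ y, lin P R K g x₀ h b y ^ 2 ∂P)) := by ring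
    _ ≤ d * C / √n * (1 / √ε * √(1 / h)) :=
      mul_le_mul_of_nonneg_left (H.norm_div_sqrt_le hε hh hb) (by positivity)
    _ = _ := by
      rw [one_div (n * h), mul_inv, Real.sqrt_mul (by positivity), Real.sqrt_inv, one_div h]
      ring

lemma measureReal_ge_le {f : Ω → ℝ} (hf : Integrable f μ) (h0 : ∀ ω, 0 ≤ f ω) {e r : ℝ}
    (he : ∫ ω, f ω ∂μ ≤ e) (hr : 0 < r) : μ.real {ω | r ≤ f ω} ≤ e / r := by
  rw [le_div_iff₀ hr, mul_comm]
  exact (mul_meas_ge_le_integral_of_nonneg (ae_of_all _ h0) hf r).trans he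

/-- The relative error of the variance estimator is `O(1 / √(n h))` in mean. -/
lemma GoodBandwidth.integral_abs_empVar_le [IsProbabilityMeasure μ] [IsProbabilityMeasure P]
    (hlaw : ∀ i, HasLaw (X i) P μ) (hindep : iIndepFun X μ) (hR : Measurable R)
    (hK : Measurable K) (hg : Measurable g) {δ C ε h : ℝ}
    (H : GoodBandwidth P R K g x₀ δ C ε h) (hC : 0 ≤ C) (hε : 0 < ε) (hh : 0 < h)
    {b : Fin d → ℝ} (hb : b ≠ 0) {n : ℕ} (hn : n ≠ 0) :
    Integrable (fun ω => |empVar n (lin P R K g x₀ h b) (fun i => X i ω)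
      / (∫ y, lin P R K g x₀ h b y ^ 2 ∂P) - 1|) μ ∧
    ∫ ω, |empVar n (lin P R K g x₀ h b) (fun i => X i ω)
      / (∫ y, lin P R K g x₀ h b y ^ 2 ∂P) - 1| ∂μ ≤ 2 * (d * C / √ε) * √(1 / (n * h)) := by
  obtain ⟨h1, h2⟩ := integral_abs_empVar_div_sub_one_le hlaw hindep (measurable_lin hR hK hg b)
    (abs_lin_le H.integrable H.integral_le b) (integral_lin hR hK hg H.integrable b)
    (H.variance_pos hε hh hb) hn
  refine ⟨h1, h2.trans ?_⟩
  rw [mul_assoc]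
  exact mul_le_mul_of_nonneg_left (H.ratio_le hC hε hh hb n) zero_le_two

/-- The plug-in variance estimator is consistent at rate `1 / √(n h)`. -/
theorem isBigOInProbability_SigHat [IsProbabilityMeasure μ] [IsProbabilityMeasure P]
    (hlaw : ∀ i, HasLaw (X i) P μ) (hindep : iIndepFun X μ)
    (hdgp : DGPAssumption P R υ K g x₀) (hdesign : DesignAssumption G g x₀)
    (hpos : ∀ n, 0 < h n) (hzero : Tendsto h atTop (𝓝 0)) {c : Fin d → ℝ} (hc : c ≠ 0) :
    IsBigOInProbability μ
      (fun n ω => |(c ⬝ᵥ SigHat P R K g x₀ (h n) n (fun i => X i ω) *ᵥ c)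
          / (c ⬝ᵥ Sig P R K g x₀ (h n) *ᵥ c) - 1|)
      (fun n => √(1 / ((n : ℝ) * h n))) := by
  obtain ⟨δ, C, ε, hC, hε, -, -, hgood⟩ := eventually_goodBandwidth hdgp hdesign hpos hzero
  have hR := hdgp.basis.measurable
  have hK := hdgp.kernel.measurable
  have hg := hdesign.measurable
  intro η hη
  set D := 2 * (d * C / √ε) with hD
  have hD0 : 0 ≤ D := by positivity
  -- Markov's inequality gives probability at most `D * η / (D + 1) ≤ η`; the added 1 keeps the
  -- threshold positive when `D = 0`.
  refine ⟨(D + 1) / η, ?_⟩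
  filter_upwards [hgood, eventually_ge_atTop 1] with n H hn
  have hn0 : n ≠ 0 := by omega
  have hn' : (0 : ℝ) < n := by exact_mod_cast hn
  have hrate : 0 < √(1 / ((n : ℝ) * h n)) := by
    have := hpos n
    positivity
  obtain ⟨hint, hle⟩ := H.integral_abs_empVar_le hlaw hindep hR hK hg hC hε (hpos n) hc hn0
  have hmarkov := measureReal_ge_le hint (fun ω => abs_nonneg _) hle
    (r := (D + 1) / η * √(1 / ((n : ℝ) * h n))) (by positivity)
  have hbound : D * √(1 / ((n : ℝ) * h n)) / ((D + 1) / η * √(1 / ((n : ℝ) * h n))) ≤ η := by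
    rw [mul_div_mul_right _ _ hrate.ne', div_div_eq_mul_div, div_le_iff₀ (by positivity)]
    nlinarith
  refine le_trans (measure_mono fun ω hω => ?_)
    ((ENNReal.le_ofReal_iff_toReal_le (measure_ne_top _ _) hη.le).2 (hmarkov.trans hbound))
  simp only [mem_ofPred_eq, abs_abs] at hω ⊢
  rw [dotProduct_SigHat H.integrable hn0, dotProduct_Sig hR hK hg (hpos n) H.integrable] at hω
  exact hω.le

lemma tendsto_const_mul_sqrt {u : ℕ → ℝ} (hu : Tendsto u atTop (𝓝 0)) (C : ℝ) :
    Tendsto (fun n => C * √(u n)) atTop (𝓝 0) := by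
  simpa using hu.sqrt.const_mul C

lemma tendstoInMeasure_const {b : ℕ → ℝ} {l : ℝ} (hb : Tendsto b atTop (𝓝 l)) :
    TendstoInMeasure μ (fun n (_ : Ω) => b n) atTop (fun _ => l) := by
  rw [tendstoInMeasure_iff_norm]
  intro η hη
  refine tendsto_const_nhds.congr' ?_
  filter_upwards [(tendsto_iff_norm_sub_tendsto_zero.1 hb).eventually_lt_const hη] with n hn
  have : {ω : Ω | η ≤ ‖b n - l‖} = ∅ := eq_empty_of_forall_notMem fun _ hω => not_le.2 hn hω
  rw [this, measure_empty]

lemma aemeasurable_empVar (hX : ∀ i, AEMeasurable (X i) μ) {f : ℝ → ℝ} (hf : Measurable f)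
    (n : ℕ) : AEMeasurable (fun ω => empVar n f (fun i => X i ω)) μ := by
  have h1 := aemeasurable_avg hX hf n
  unfold empVar
  rw [show (fun ω => avg n (fun y => (f y - avg n f fun i => X i ω) ^ 2) fun i => X i ω)
    = fun ω => 1 / (n : ℝ) * ∑ i ∈ Finset.range n, (f (X i ω) - avg n f fun i => X i ω) ^ 2
    from rfl]
  exact (Finset.aemeasurable_fun_sum _ fun i _ =>
    ((hf.comp_aemeasurable (hX i)).sub h1).pow_const 2).const_mul _

/-- Convergence in mean to `1` gives convergence in probability of the inverse square root. -/
lemma tendstoInMeasure_one_div_sqrt [IsFiniteMeasure μ] {V : ℕ → Ω → ℝ} {e : ℕ → ℝ}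
    (hV : ∀ᶠ n in atTop, Integrable (fun ω => |V n ω - 1|) μ ∧ ∫ ω, |V n ω - 1| ∂μ ≤ e n)
    (he : Tendsto e atTop (𝓝 0)) :
    TendstoInMeasure μ (fun n ω => 1 / √(V n ω)) atTop (fun _ => 1) := by
  rw [tendstoInMeasure_iff_measureReal_norm]
  intro η hη
  have hcont : ContinuousAt (fun y : ℝ => 1 / √y) 1 :=
    continuousAt_const.div Real.continuous_sqrt.continuousAt (by simp)
  obtain ⟨r, hr, hball⟩ := Metric.continuousAt_iff.1 hcont η hη
  have hlim : Tendsto (fun n => e n / r) atTop (𝓝 0) := by simpa using he.div_const r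
  refine tendsto_of_tendsto_of_tendsto_of_le_of_le' tendsto_const_nhds hlim
    (Eventually.of_forall fun _ => measureReal_nonneg) ?_
  filter_upwards [hV] with n hn
  refine le_trans (measureReal_mono fun ω hω => ?_)
    (measureReal_ge_le hn.1 (fun ω => abs_nonneg _) hn.2 hr)
  simp only [mem_ofPred_eq] at hω ⊢
  by_contra hlt
  have := hball (x := V n ω) (by rw [Real.dist_eq]; exact not_le.1 hlt)
  rw [Real.dist_eq, Real.sqrt_one, div_one] at this
  exact absurd hω (not_le.2 this)

lemma sandwich_eq (D c : Fin d → ℝ) {Γ : Matrix (Fin d) (Fin d) ℝ} (hΓ : Γ.IsSymm)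
    (S : Matrix (Fin d) (Fin d) ℝ) :
    c ⬝ᵥ (Matrix.diagonal D * Γ⁻¹ * S * Γ⁻¹ * Matrix.diagonal D) *ᵥ c
      = (Γ⁻¹ *ᵥ (Matrix.diagonal D *ᵥ c)) ⬝ᵥ S *ᵥ (Γ⁻¹ *ᵥ (Matrix.diagonal D *ᵥ c)) := by
  have hinv : Γ⁻¹ᵀ = Γ⁻¹ := by rw [Matrix.transpose_nonsing_inv, hΓ.eq]
  simp only [← Matrix.mulVec_mulVec, Matrix.mul_assoc]
  rw [Matrix.dotProduct_mulVec, ← Matrix.mulVec_transpose, Matrix.diagonal_transpose,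
    Matrix.dotProduct_mulVec, ← Matrix.mulVec_transpose, hinv]

/-- The studentized statistic as a product of standardized terms. -/
lemma studentized_eq {S B V s N : ℝ} (hN : 0 < N) (hs : 0 < s) :
    (S + B) / √(V / N) = (√N * S / √s + √N * B / √s) * (1 / √(V / s)) := by
  have h1 : √N ≠ 0 := (Real.sqrt_pos.2 hN).ne'
  have h2 : √s ≠ 0 := (Real.sqrt_pos.2 hs).ne'
  rw [Real.sqrt_div' _ hN.le, Real.sqrt_div' _ hs.le]
  -- If the variance estimate degenerates, both sides are 0 by the convention for division by zero,
  -- so no event has to be excluded.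
  rcases eq_or_ne √V 0 with h0 | h0
  · simp [h0]
  · field_simp

/-- The studentized local `L²` estimator is asymptotically standard normal. -/
theorem tendstoInDistribution_studentized [IsProbabilityMeasure μ] [IsProbabilityMeasure P]
    (hlaw : ∀ i, HasLaw (X i) P μ) (hindep : iIndepFun X μ)
    (hdgp : DGPAssumption P R υ K g x₀) (hdesign : DesignAssumption G g x₀)
    (hpos : ∀ n, 0 < h n) (hzero : Tendsto h atTop (𝓝 0))
    (hnh : Tendsto (fun n : ℕ => (n : ℝ) * h n) atTop atTop) {c : Fin d → ℝ} (hc : c ≠ 0)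
    (θ : Fin d → ℝ) (θhat : ℕ → Ω → Fin d → ℝ) (hmeas : ∀ n, AEMeasurable (θhat n) μ)
    (hmin : ∀ n ω, IsMinOn (criterion P R K G x₀ (h n) n (fun i => X i ω)) univ (θhat n ω))
    (hbias : Tendsto (fun n : ℕ => (n : ℝ) * approxError P R x₀ θ (h n) ^ 2 / h n) atTop (𝓝 0)) :
    TendstoInDistribution
      (fun (n : ℕ) (ω : Ω) =>
        (c ⬝ᵥ (θhat n ω - θ)) /
          √((c ⬝ᵥ (Matrix.diagonal (υ (h n)) * (Gam P R K g x₀ (h n))⁻¹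
              * SigHat P R K g x₀ (h n) n (fun i => X i ω)
              * (Gam P R K g x₀ (h n))⁻¹ * Matrix.diagonal (υ (h n))) *ᵥ c) / (n : ℝ)))
      atTop (id : ℝ → ℝ) (fun _ => μ) (gaussianReal 0 1) := by
  obtain ⟨δ, C, ε, hC, hε, hG, hg0, hgood⟩ := eventually_goodBandwidth hdgp hdesign hpos hzero
  have hR := hdgp.basis.measurable
  have hK := hdgp.kernel.measurable
  have hg := hdesign.measurable
  have hX i := (hlaw i).aemeasurable
  simp_rw [sandwich_eq _ c isSymm_Gam]
  set a : ℕ → Fin d → ℝ := fun n =>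
    (Gam P R K g x₀ (h n))⁻¹ *ᵥ (Matrix.diagonal (υ (h n)) *ᵥ c) with ha
  set f : ℕ → ℝ → ℝ := fun n => lin P R K g x₀ (h n) (a n) with hf
  set s : ℕ → ℝ := fun n => ∫ y, f n y ^ 2 ∂P with hs
  set β : ℕ → ℝ := fun n => √n * (a n ⬝ᵥ bias P R K g x₀ (h n) θ) / √(s n) with hβ
  have hfm (n : ℕ) : Measurable (f n) := measurable_lin hR hK hg _
  have ha0 : ∀ᶠ n in atTop, a n ≠ 0 := by
    filter_upwards [hgood] with n H h0
    -- If `a n` vanished, this product would too, forcing `c = 0` because the entries of the scaling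
    -- are positive.
    have h1 : Gam P R K g x₀ (h n) *ᵥ a n = Matrix.diagonal (υ (h n)) *ᵥ c := by
      rw [ha, Matrix.mulVec_mulVec, Matrix.mul_nonsing_inv _ (isUnit_iff_ne_zero.2 H.det_ne_zero),
        Matrix.one_mulVec]
    rw [h0, Matrix.mulVec_zero] at h1
    refine hc (funext fun j => ?_)
    have h2 := congrFun h1 j
    rw [Matrix.mulVec_diagonal, Pi.zero_apply, zero_eq_mul] at h2
    exact h2.resolve_left (hdgp.basis.scale_pos (h n) (hpos n) j).ne'
  have hsp : ∀ᶠ n in atTop, 0 < s n := by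
    filter_upwards [hgood, ha0] with n H h0
    exact H.variance_pos hε (hpos n) h0
  have hrate : Tendsto (fun n : ℕ => 1 / ((n : ℝ) * h n)) atTop (𝓝 0) :=
    tendsto_const_nhds.div_atTop hnh
  have hclt : TendstoInDistribution
      (fun (n : ℕ) ω => √n * avg n (f n) (fun i => X i ω) / √(s n))
      atTop (id : ℝ → ℝ) (fun _ => μ) (gaussianReal 0 1) := by
    refine tendstoInDistribution_avg hlaw hindep hfm (C := fun n => √(a n ⬝ᵥ a n) * (d * C))
      ?_ ?_ hsp ?_
    · filter_upwards [hgood] with n H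
      exact abs_lin_le H.integrable H.integral_le _
    · filter_upwards [hgood] with n H
      exact integral_lin hR hK hg H.integrable _
    · refine squeeze_zero' (Eventually.of_forall fun n => by positivity) ?_
        (tendsto_const_mul_sqrt hrate (d * C / √ε))
      filter_upwards [hgood, ha0] with n H h0
      exact H.ratio_le hC hε (hpos n) h0 n
  have hβ0 : Tendsto β atTop (𝓝 0) := by
    -- Undersmoothing: the bias in standard-deviation units is at most a constant times √(n
    -- ϱ(h)²/h).
    refine squeeze_zero_norm' ?_ (tendsto_const_mul_sqrt hbias (d * C / √ε))
    filter_upwards [hgood, ha0] with n H h0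
    have hρ := approxError_nonneg (P := P) (R := R) (x₀ := x₀) (h := h n) θ
    have h1 : |a n ⬝ᵥ bias P R K g x₀ (h n) θ|
        ≤ √(a n ⬝ᵥ a n) * (d * (C * approxError P R x₀ θ (h n))) :=
      abs_dotProduct_le _ _ (abs_bias_le hdgp.kernel hdgp.basis (hpos n) H.integrable
        H.integral_le θ)
    rw [Real.norm_eq_abs, hβ, abs_div, abs_mul, abs_of_nonneg (Real.sqrt_nonneg _),
      abs_of_nonneg (Real.sqrt_nonneg _)]
    calc √n * |a n ⬝ᵥ bias P R K g x₀ (h n) θ| / √(s n)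
        ≤ √n * (√(a n ⬝ᵥ a n) * (d * (C * approxError P R x₀ θ (h n)))) / √(s n) := by gcongr
      _ = √n * d * C * approxError P R x₀ θ (h n) * (√(a n ⬝ᵥ a n) / √(s n)) := by ring
      _ ≤ √n * d * C * approxError P R x₀ θ (h n) * (1 / √ε * √(1 / h n)) :=
        mul_le_mul_of_nonneg_left (H.norm_div_sqrt_le hε (hpos n) h0) (by positivity)
      _ = d * C / √ε * √((n : ℝ) * approxError P R x₀ θ (h n) ^ 2 / h n) := by
        rw [Real.sqrt_div' _ (hpos n).le, Real.sqrt_div' _ (hpos n).le,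
          Real.sqrt_mul (Nat.cast_nonneg n), Real.sqrt_sq hρ, Real.sqrt_one]
        ring
  set r : ℕ → Ω → ℝ := fun n ω => 1 / √(empVar n (f n) (fun i => X i ω) / s n) with hr
  have hrm (n : ℕ) : AEMeasurable (r n) μ :=
    (((aemeasurable_empVar hX (hfm n) n).div_const _).sqrt).const_div _
  have hr1 : TendstoInMeasure μ r atTop (fun _ => 1) := by
    refine tendstoInMeasure_one_div_sqrt
      (e := fun n => 2 * (d * C / √ε) * √(1 / ((n : ℝ) * h n))) ?_
      (tendsto_const_mul_sqrt hrate _)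
    filter_upwards [hgood, ha0, eventually_ge_atTop 1] with n H h0 hn
    exact H.integral_abs_empVar_le hlaw hindep hR hK hg hC hε (hpos n) h0 (by omega)
  have hW : TendstoInDistribution
      (fun (n : ℕ) ω => (√n * avg n (f n) (fun i => X i ω) / √(s n) + β n) * r n ω)
      atTop (id : ℝ → ℝ) (fun _ => μ) (gaussianReal 0 1) := by
    have h1 := hclt.continuous_comp_prodMk_of_tendstoInMeasure_const
      (g := fun p : ℝ × ℝ => p.1 + p.2) (by fun_prop) (tendstoInMeasure_const hβ0)
      (fun n => aemeasurable_const)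
    have h2 := h1.continuous_comp_prodMk_of_tendstoInMeasure_const
      (g := fun p : ℝ × ℝ => p.1 * p.2) (by fun_prop) hr1 hrm
    simp only [id, add_zero, mul_one] at h2
    exact h2
  -- The statistic equals the Slutsky product pointwise, but only once the bandwidth is good and `n`
  -- is positive; the difference is thus eventually identically zero.
  refine tendstoInDistribution_of_tendstoInMeasure_sub _ _ hW ?_ fun n => ?_
  · rw [tendstoInMeasure_iff_norm]
    intro η hη
    refine tendsto_const_nhds.congr' ?_
    filter_upwards [hgood, ha0, hsp, eventually_ge_atTop 1] with n H h0 hsn hn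
    have hn0 : n ≠ 0 := by omega
    have hn' : (0 : ℝ) < n := by exact_mod_cast hn
    symm
    convert measure_empty (μ := μ) using 2
    refine eq_empty_of_forall_notMem fun ω hω => ?_
    simp only [mem_ofPred_eq, Pi.sub_apply, Pi.zero_apply, sub_zero] at hω
    rw [dotProduct_sub_eq hdgp.kernel hdgp.basis hg hg0 hG (hpos n) H.lt H.integrable
      H.det_ne_zero hn0 (hmin n ω) θ c, dotProduct_SigHat H.integrable hn0,
      studentized_eq hn' hsn, sub_self, norm_zero] at hω
    exact absurd hω (not_le.2 hη)
  · have hpath : AEMeasurable (fun ω i => X i ω) μ := aemeasurable_pi_lambda _ hX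
    refine AEMeasurable.div ?_ (AEMeasurable.sqrt (AEMeasurable.div_const ?_ _))
    · simp only [dotProduct]
      refine Finset.aemeasurable_fun_sum _ fun j _ => AEMeasurable.const_mul ?_ _
      exact (((measurable_pi_apply j).comp_aemeasurable (hmeas n)).sub_const _)
    · simp_rw [dotProduct_mulVec_eq_sum]
      refine Finset.aemeasurable_fun_sum _ fun j _ => Finset.aemeasurable_fun_sum _ fun k _ =>
        AEMeasurable.const_mul ?_ _
      exact (measurable_SigHat hR hK hg n j k).comp_aemeasurable hpath

end LocalL2

theorem mainTheorem6 {Ω : Type*} [MeasurableSpace Ω] (μ : Measure Ω) [IsProbabilityMeasure μ]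
    (P : Measure ℝ) [IsProbabilityMeasure P]
    (X : ℕ → Ω → ℝ) (hlaw : ∀ i, HasLaw (X i) P μ) (hindep : iIndepFun X μ)
    {d : ℕ} (R υ : ℝ → Fin d → ℝ) (K : ℝ → ℝ) (G : StieltjesFunction ℝ) (g : ℝ → ℝ) (x₀ : ℝ)
    (hdgp : LocalL2.DGPAssumption P R υ K g x₀) (hdesign : LocalL2.DesignAssumption G g x₀)
    (h : ℕ → ℝ) (hpos : ∀ n, 0 < h n) (hzero : Tendsto h atTop (𝓝 0))
    (hnh : Tendsto (fun n : ℕ => (n : ℝ) * h n) atTop atTop)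
    (c : Fin d → ℝ) (hc : c ≠ 0) :
    LocalL2.IsBigOInProbability μ
      (fun n ω =>
        |(c ⬝ᵥ LocalL2.SigHat P R K g x₀ (h n) n (fun i => X i ω) *ᵥ c)
          / (c ⬝ᵥ LocalL2.Sig P R K g x₀ (h n) *ᵥ c) - 1|)
      (fun n => Real.sqrt (1 / ((n : ℝ) * h n)))
    ∧
    ∀ (θ : Fin d → ℝ) (θhat : ℕ → Ω → Fin d → ℝ),
      (∀ n, AEMeasurable (θhat n) μ) →
      (∀ n ω, IsMinOn (LocalL2.criterion P R K G x₀ (h n) n (fun i => X i ω)) univ (θhat n ω)) →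
      Tendsto (fun n : ℕ => (n : ℝ) * LocalL2.approxError P R x₀ θ (h n) ^ 2 / h n) atTop (𝓝 0) →
      TendstoInDistribution
        (fun (n : ℕ) (ω : Ω) =>
          (c ⬝ᵥ (θhat n ω - θ)) /
            Real.sqrt
              ((c ⬝ᵥ (Matrix.diagonal (υ (h n)) * (LocalL2.Gam P R K g x₀ (h n))⁻¹
                * LocalL2.SigHat P R K g x₀ (h n) n (fun i => X i ω)
                * (LocalL2.Gam P R K g x₀ (h n))⁻¹ * Matrix.diagonal (υ (h n))) *ᵥ c) / (n : ℝ)))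
        atTop (id : ℝ → ℝ) (fun _ => μ) (gaussianReal 0 1) :=
  ⟨LocalL2.isBigOInProbability_SigHat hlaw hindep hdgp hdesign hpos hzero hc,
    fun θ θhat hmeas hmin hbias => LocalL2.tendstoInDistribution_studentized hlaw hindep hdgp
      hdesign hpos hzero hnh hc θ θhat hmeas hmin hbias⟩
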